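/- Consider a three-user-pair deterministic interference channel (3-DIC) with finite alphabets. Sender $l\in\{1,2,3\}$ has input $X_l$, the link signals are $X_{lk}=g_{lk}(X_l)$ for $l,k\in\{1,2,3\}$, the combined interferences are $S_1=h_1(X_{21},X_{31})$, $S_2=h_2(X_{12},X_{32})$, $S_3=h_3(X_{13},X_{23})$, and the outputs of the memoryless channel are $Y_k=f_k(X_{kk},S_k)$, where $f_k$ and $h_k$ are one-to-one in each argument when the other argument is fixed. Sender $k$ conveys an independent, uniformly distributed message $M_k\in[1:2^{nR_k}]$ (that is, one of $2^{\lceil nR_k\rceil}$ messages) to receiver $k$ in $n$ channel uses. A nonnegative rate triple $(R_1,R_2,R_3)$ is achievable if there is a sequence of $(2^{nR_1},2^{nR_2},2^{nR_3},n)$ codes with $\mathrm{P}\{\hat M_k\ne M_k\text{ for some }k\}\to 0$ as $n\to\infty$, and the capacity region is the closure of the set of achievable rate triples. Entropies are in bits. Assume (strong interference) $\min\{H(X_{12}),H(X_{13})\}\ge H(X_{11})$, $\min\{H(X_{21}),H(X_{23})\}\ge H(X_{22})$, $\min\{H(X_{31}),H(X_{32})\}\ge H(X_{33})$, and (invertible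 $h_k$) $H(S_1)=H(X_{21})+H(X_{31})$, $H(S_2)=H(X_{12})+H(X_{32})$, $H(S_3)=H(X_{13})+H(X_{23})$, for all product input pmfs $p(x_1)p(x_2)p(x_3)$. Then the capacity region is the set of nonnegative rate triples $(R_1,R_2,R_3)$ such that \begin{align*} R_k &\le H(X_{kk}\mid Q),\quad k\in\{1,2,3\},\\ R_1+R_2 &\le \min\{H(Y_1\mid X_{31},Q),\,H(Y_2\mid X_{32},Q)\},\\ R_1+R_3 &\le \min\{H(Y_1\mid X_{21},Q),\,H(Y_3\mid X_{23},Q)\},\\ R_2+R_3 &\le \min\{H(Y_2\mid X_{12},Q),\,H(Y_3\mid X_{13},Q)\},\\ R_1+R_2+R_3 &\le \min\{H(Y_1\mid Q),\,H(Y_2\mid Q),\,H(Y_3\mid Q)\} \end{align*} for some $(Q,X_1,X_2,X_3)\sim p(q)p(x_1|q)p(x_2|q)p(x_3|q)$ with $Q$ taking finitely many values. Moreover, every nonnegative rate triple that satisfies all these inequalities strictly for some such $(Q,X_1,X_2,X_3)$ is achievable, and, if none of $g_{11},g_{22},g_{33}$ is constant, the capacity region is the closure of the set of these triples. -/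

import Mathlib

/-! ### Entropy of random variables on a finite probability space (in bits) -/

namespace FiniteEntropy

variable {Ω α β : Type*} [Fintype Ω]

open Classical in
/-- `P(A = a)` for a random variable `A` on the finite space `Ω` with pmf `P`. -/
noncomputable def prob (P : Ω → ℝ) (A : Ω → α) (a : α) : ℝ :=
  ∑ ω with A ω = a, P ω

/-- Entropy `H(A) = - ∑ₐ p(a) log₂ p(a)`. -/
noncomputable def H [Fintype α] (P : Ω → ℝ) (A : Ω → α) : ℝ :=
  - ∑ a, prob P A a * Real.logb 2 (prob P A a)

/-- Conditional entropy `H(A | B) = - ∑_{a,b} p(a,b) log₂ (p(a,b) / p(b))`.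
Terms with `p(a,b) = 0` vanish. -/
noncomputable def condH [Fintype α] [Fintype β] (P : Ω → ℝ) (A : Ω → α) (B : Ω → β) : ℝ :=
  - ∑ a, ∑ b, prob P (fun ω => (A ω, B ω)) (a, b) *
      Real.logb 2 (prob P (fun ω => (A ω, B ω)) (a, b) / prob P B b)

end FiniteEntropy

/-! ### The three-user-pair deterministic interference channel

Users are indexed by `0, 1, 2 : Fin 3` (for users 1, 2, 3). -/

/-- The interfering senders at receivers `0, 1, 2` are `{1, 2}`, `{0, 2}`, `{0, 1}`;
`intfA` is the smaller one and `intfB` the larger one. -/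
def intfA : Fin 3 → Fin 3 := ![1, 0, 0]

/-- The larger of the two senders interfering at a receiver. -/
def intfB : Fin 3 → Fin 3 := ![2, 2, 1]

/-- A 3-DIC with input alphabets `X l`, alphabets `V l k` of the signals `X_{lk} = g_{lk}(X_l)`
on the link from sender `l` to receiver `k`, combined interference alphabets `S k` and
output alphabets `Y k`. The combining functions `h k` and the receiver functions `f k` are
one-to-one in each argument when the other one is fixed. -/
structure DIC3 (X : Fin 3 → Type*) (V : Fin 3 → Fin 3 → Type*) (S Y : Fin 3 → Type*) where
  /-- loss functions -/
  g : ∀ l k, X l → V l k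
  /-- interference combining functions -/
  h : ∀ k, V (intfA k) k → V (intfB k) k → S k
  /-- receiver functions -/
  f : ∀ k, V k k → S k → Y k
  h_inj_left : ∀ k b, Function.Injective (fun a => h k a b)
  h_inj_right : ∀ k a, Function.Injective (fun b => h k a b)
  f_inj_left : ∀ k s, Function.Injective (fun v => f k v s)
  f_inj_right : ∀ k v, Function.Injective (fun s => f k v s)

/-- A conditional product input distribution `p(q) p(x₁|q) p(x₂|q) p(x₃|q)` with a
time-sharing variable `Q` on a finite alphabet (of arbitrary size, labelled by `Fin m`). -/
structure TimeSharedInput (X : Fin 3 → Type*) [∀ k, Fintype (X k)] where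
  /-- size of the alphabet of `Q` -/
  m : ℕ
  /-- the pmf `p(q)` -/
  pQ : Fin m → ℝ
  pQ_mem : pQ ∈ stdSimplex ℝ (Fin m)
  /-- the conditional pmfs `p(x_k | q)` -/
  pX : ∀ k, Fin m → X k → ℝ
  pX_mem : ∀ k q, pX k q ∈ stdSimplex ℝ (X k)

/-- The joint pmf of `(Q, X₁, X₂, X₃)`. -/
noncomputable def TimeSharedInput.law {X : Fin 3 → Type*} [∀ k, Fintype (X k)]
    (p : TimeSharedInput X) : Fin p.m × (∀ k, X k) → ℝ :=
  fun ω => p.pQ ω.1 * ∏ k, p.pX k ω.1 (ω.2 k)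

/-- The product pmf `p(x₁) p(x₂) p(x₃)`. -/
noncomputable def productLaw {X : Fin 3 → Type*} (p : ∀ k, X k → ℝ) : (∀ k, X k) → ℝ :=
  fun x => ∏ k, p k (x k)

/-- A code of block length `n` with `M k` messages for user pair `k`. -/
structure DIC3Code (X Y : Fin 3 → Type*) (n : ℕ) (M : Fin 3 → ℕ) where
  /-- encoders -/
  enc : ∀ k, Fin (M k) → Fin n → X k
  /-- decoders -/
  dec : ∀ k, (Fin n → Y k) → Fin (M k)

/-- The message set sizes `2^⌈n R_k⌉` of a `(2^{nR₁}, 2^{nR₂}, 2^{nR₃}, n)` code. -/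
noncomputable def numMessages (n : ℕ) (R : Fin 3 → ℝ) : Fin 3 → ℕ :=
  fun k => 2 ^ ⌈(n : ℝ) * R k⌉₊

namespace DIC3

variable {X : Fin 3 → Type*} {V : Fin 3 → Fin 3 → Type*} {S Y : Fin 3 → Type*}

/-- `X_{lk} = g_{lk}(X_l)` as a function of the channel inputs. -/
def link (C : DIC3 X V S Y) (l k : Fin 3) (x : ∀ j, X j) : V l k := C.g l k (x l)

/-- The combined interference `S_k` as a function of the channel inputs, i.e.
`S₁ = h₁(X₂₁, X₃₁)`, `S₂ = h₂(X₁₂, X₃₂)`, `S₃ = h₃(X₁₃, X₂₃)`. -/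
def intf (C : DIC3 X V S Y) (k : Fin 3) (x : ∀ j, X j) : S k :=
  C.h k (C.link (intfA k) k x) (C.link (intfB k) k x)

/-- The channel output `Y_k = f_k(X_{kk}, S_k)` as a function of the channel inputs. -/
def output (C : DIC3 X V S Y) (k : Fin 3) (x : ∀ j, X j) : Y k :=
  C.f k (C.link k k x) (C.intf k x)

/-! #### Codes, achievability, capacity region -/

open Classical in
/-- The probability that some receiver `k` decodes a message different from `M_k`, when
the messages are independent and uniformly distributed: as the channel is deterministic, this is
the fraction of the message triples for which an error occurs. -/
noncomputable def errorProb (C : DIC3 X V S Y) {n : ℕ} {M : Fin 3 → ℕ}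
    (c : DIC3Code X Y n M) : ℝ :=
  (Finset.card {w : ∀ k, Fin (M k) |
      ∃ k, c.dec k (fun i => C.output k (fun l => c.enc l (w l) i)) ≠ w k} : ℝ) /
    (Fintype.card (∀ k, Fin (M k)) : ℝ)

/-- A triple of nonnegative rates is achievable if there is a sequence of
`(2^{nR₁}, 2^{nR₂}, 2^{nR₃}, n)` codes whose error probability tends to `0`. -/
def achievable (C : DIC3 X V S Y) : Set (Fin 3 → ℝ) :=
  {R | (∀ k, 0 ≤ R k) ∧ ∃ c : ∀ n : ℕ, DIC3Code X Y n (numMessages n R),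
    Filter.Tendsto (fun n => C.errorProb (c n)) Filter.atTop (nhds 0)}

/-- The capacity region: the closure of the set of achievable rate triples. -/
def capacityRegion (C : DIC3 X V S Y) : Set (Fin 3 → ℝ) := closure C.achievable

/-! #### Strong interference and invertibility -/

variable [∀ k, Fintype (X k)] [∀ l k, Fintype (V l k)]

/-- Strong interference: `min {H(X_{lk}) : k ≠ l} ≥ H(X_{ll})` for each sender `l` and all
product input pmfs. -/
def StrongInterference (C : DIC3 X V S Y) : Prop :=
  ∀ p : ∀ k, X k → ℝ, (∀ k, p k ∈ stdSimplex ℝ (X k)) →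
    ∀ l k, k ≠ l →
      FiniteEntropy.H (productLaw p) (C.link l l) ≤ FiniteEntropy.H (productLaw p) (C.link l k)

/-- Invertibility of the `h_k`: `H(S₁) = H(X₂₁) + H(X₃₁)`, `H(S₂) = H(X₁₂) + H(X₃₂)` and
`H(S₃) = H(X₁₃) + H(X₂₃)` for all product input pmfs. -/
def InvertibleCombining [∀ k, Fintype (S k)] (C : DIC3 X V S Y) : Prop :=
  ∀ p : ∀ k, X k → ℝ, (∀ k, p k ∈ stdSimplex ℝ (X k)) →
    ∀ k, FiniteEntropy.H (productLaw p) (C.intf k) =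
      FiniteEntropy.H (productLaw p) (C.link (intfA k) k) +
        FiniteEntropy.H (productLaw p) (C.link (intfB k) k)

/-! #### The entropy region -/

variable [∀ k, Fintype (Y k)]

/-- `H(X_{kk} | Q)`. -/
noncomputable def HX (C : DIC3 X V S Y) (p : TimeSharedInput X) (k : Fin 3) : ℝ :=
  FiniteEntropy.condH p.law (fun ω => C.link k k ω.2) (fun ω => ω.1)

/-- `H(Y_k | X_{lk}, Q)`. -/
noncomputable def HYX (C : DIC3 X V S Y) (p : TimeSharedInput X) (k l : Fin 3) : ℝ :=
  FiniteEntropy.condH p.law (fun ω => C.output k ω.2) (fun ω => (C.link l k ω.2, ω.1))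

/-- `H(Y_k | Q)`. -/
noncomputable def HY (C : DIC3 X V S Y) (p : TimeSharedInput X) (k : Fin 3) : ℝ :=
  FiniteEntropy.condH p.law (fun ω => C.output k ω.2) (fun ω => ω.1)

/-- Nonnegative rate triples satisfying the entropy bounds with strict inequality for some
`(Q, X₁, X₂, X₃) ∼ p(q) p(x₁|q) p(x₂|q) p(x₃|q)`. -/
def strictRegion (C : DIC3 X V S Y) : Set (Fin 3 → ℝ) :=
  {R | (∀ k, 0 ≤ R k) ∧ ∃ p : TimeSharedInput X,
    (∀ k, R k < C.HX p k) ∧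
    R 0 + R 1 < min (C.HYX p 0 2) (C.HYX p 1 2) ∧
    R 0 + R 2 < min (C.HYX p 0 1) (C.HYX p 2 1) ∧
    R 1 + R 2 < min (C.HYX p 1 0) (C.HYX p 2 0) ∧
    R 0 + R 1 + R 2 < min (C.HY p 0) (min (C.HY p 1) (C.HY p 2))}

/-- Nonnegative rate triples satisfying the entropy bounds with non-strict inequality for some
`(Q, X₁, X₂, X₃) ∼ p(q) p(x₁|q) p(x₂|q) p(x₃|q)`. -/
def closedRegion (C : DIC3 X V S Y) : Set (Fin 3 → ℝ) :=
  {R | (∀ k, 0 ≤ R k) ∧ ∃ p : TimeSharedInput X,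
    (∀ k, R k ≤ C.HX p k) ∧
    R 0 + R 1 ≤ min (C.HYX p 0 2) (C.HYX p 1 2) ∧
    R 0 + R 2 ≤ min (C.HYX p 0 1) (C.HYX p 2 1) ∧
    R 1 + R 2 ≤ min (C.HYX p 1 0) (C.HYX p 2 0) ∧
    R 0 + R 1 + R 2 ≤ min (C.HY p 0) (min (C.HY p 1) (C.HY p 2))}

end DIC3

/-! The theorem has three parts: random coding, a converse, and the comparison of the open and the
closed description of the region.

**Random coding.** Receiver `k` looks for any message triple whose codewords reproduce its output
exactly; it only needs the `k`-th entry of the triple to be correct. Let `T ∋ k` be the set of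
senders whose messages are wrong. Given the correct inputs `x`, independent new inputs of the
senders in `T` leave the output at one time unchanged with a probability `W(x)`
(`DIC3.confusion`).
The mean of `-log₂ W` is exactly the entropy that bounds the sum of the rates in `T`
(`DIC3.letterBound_eq_confusion`): `H(X_{kk} | Q)` for `T = {k}`, `H(Y_k | X_{lk}, Q)` if only `l`
is correct, and `H(Y_k | Q)` if all messages are wrong. By `min 1 a ≤ a ^ s`, the union bound shows
that the error probability is at most `N ^ s * (E[W ^ s]) ^ n`, with `N` about `2 ^ (n ρ)` wrong
candidates, where `ρ` is the sum of the rates in `T` (`DIC3.sum_sum_confused_le`). The derivative of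
`s ↦ 2 ^ (s ρ) * E[W ^ s]` at `0` is negative if `ρ` is less than the entropy, so a small `s` gives
exponential decay (`exists_rpow_mean_lt_one`). This uses neither strong interference nor
invertibility, and no typical sequences.

**Converse.** Tested on inputs that are uniform on two letters, strong interference says that the
signal on a cross link determines the one on the direct link; tested on uniform inputs,
invertibility says that `S_k` determines both interfering signals. For a code with block signals
(superscript `n`), Fano's inequality at receiver `k` and `H(Y_k^n | M_k) = H(S_k^n)` give
`log M_k + H(X_{ak}^n) + H(X_{bk}^n) ≤ H(Y_k^n) + n ε` for the interferers `a`, `b`. The remaining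
rates enter through `log M_a ≤ H(X_{aa}^n) + n ε ≤ H(X_{ak}^n) + n ε`. Gibbs' inequality
(`FiniteEntropy.condH_le_of_kernel`) bounds block entropies by sums of letter entropies, and a
uniform time index serves as `Q`. The error terms vanish in the limit because
`DIC3.closedRegion` is closed: time sharing takes the convex hull of the compact set of entropy
vectors of product inputs, which is compact by Carathéodory's theorem.

**Closure.** Mixing the inputs with a small share of uniform ones makes all bounds of receivers with
nonconstant `g_{kk}` strict for a slightly scaled-down rate triple. A receiver with constant
`g_{kk}` has rate `0` and a single message, so it imposes no condition on a code. -/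

set_option linter.unusedSectionVars false

/-! ### Entropy on a finite probability space -/

namespace FiniteEntropy

variable {Ω α β : Type*} [Fintype Ω]

theorem prob_nonneg {P : Ω → ℝ} (hP : ∀ ω, 0 ≤ P ω) (A : Ω → α) (a : α) : 0 ≤ prob P A a :=
  Finset.sum_nonneg fun ω _ => hP ω

theorem le_prob {P : Ω → ℝ} (hP : ∀ ω, 0 ≤ P ω) (A : Ω → α) (ω : Ω) : P ω ≤ prob P A (A ω) := by
  classical
  unfold prob
  exact Finset.single_le_sum (f := P) (fun i _ => hP i) (by simp)

theorem prob_pos {P : Ω → ℝ} (hP : ∀ ω, 0 ≤ P ω) (A : Ω → α) {ω : Ω} (hω : P ω ≠ 0) :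
    0 < prob P A (A ω) :=
  (lt_of_le_of_ne (hP ω) hω.symm).trans_le (le_prob hP A ω)

open Classical in
theorem prob_eq_sum_ite (P : Ω → ℝ) (A : Ω → α) (a : α) :
    prob P A a = ∑ ω, P ω * if A ω = a then 1 else 0 := by
  simp [prob, Finset.sum_filter]

theorem sum_prob_mul [Fintype α] (P : Ω → ℝ) (A : Ω → α) (f : α → ℝ) :
    ∑ a, prob P A a * f a = ∑ ω, P ω * f (A ω) := by
  classical
  simp only [prob_eq_sum_ite, Finset.sum_mul]
  rw [Finset.sum_comm]
  refine Finset.sum_congr rfl fun ω _ => ?_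
  simp

theorem sum_prob [Fintype α] (P : Ω → ℝ) (A : Ω → α) : ∑ a, prob P A a = ∑ ω, P ω := by
  simpa using sum_prob_mul P A (fun _ => 1)

/-- Marginalization of a joint pmf. -/
theorem sum_prob_pair [Fintype α] (P : Ω → ℝ) (A : Ω → α) (B : Ω → β) (b : β) :
    ∑ a, prob P (fun ω => (A ω, B ω)) (a, b) = prob P B b := by
  classical
  simp only [prob_eq_sum_ite]
  rw [Finset.sum_comm]
  refine Finset.sum_congr rfl fun ω _ => ?_
  by_cases h : B ω = b <;> simp [h, Prod.ext_iff]

theorem prob_congr {P : Ω → ℝ} {A : Ω → α} {B : Ω → β} {a : α} {b : β}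
    (h : ∀ ω, A ω = a ↔ B ω = b) : prob P A a = prob P B b := by
  classical
  simp only [prob_eq_sum_ite, h]

theorem prob_mono_fiber {P : Ω → ℝ} (hP : ∀ ω, 0 ≤ P ω) {A : Ω → α} {B : Ω → β} {ω : Ω}
    (h : ∀ ω', A ω' = A ω → B ω' = B ω) : prob P A (A ω) ≤ prob P B (B ω) := by
  classical
  simp only [prob_eq_sum_ite]
  refine Finset.sum_le_sum fun ω' _ => mul_le_mul_of_nonneg_left ?_ (hP ω')
  by_cases h1 : A ω' = A ω
  · simp [h1, h ω' h1]
  · simp only [h1, if_false]; split_ifs <;> norm_num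

/-- The entropy as the mean of the information `-log₂ p(A)`. -/
theorem H_eq_sum [Fintype α] (P : Ω → ℝ) (A : Ω → α) :
    H P A = - ∑ ω, P ω * Real.logb 2 (prob P A (A ω)) := by
  rw [H, sum_prob_mul P A fun a => Real.logb 2 (prob P A a)]

/-- The conditional entropy as the mean of the conditional information `-log₂ p(A | B)`. -/
theorem condH_eq_sum [Fintype α] [Fintype β] (P : Ω → ℝ) (A : Ω → α) (B : Ω → β) :
    condH P A B = - ∑ ω, P ω *
      Real.logb 2 (prob P (fun ω => (A ω, B ω)) (A ω, B ω) / prob P B (B ω)) := by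
  rw [condH, ← sum_prob_mul P (fun ω => (A ω, B ω)) fun c =>
    Real.logb 2 (prob P (fun ω => (A ω, B ω)) c / prob P B c.2), Fintype.sum_prod_type]

theorem condH_eq_sub [Fintype α] [Fintype β] {P : Ω → ℝ} (hP : ∀ ω, 0 ≤ P ω)
    (A : Ω → α) (B : Ω → β) :
    condH P A B = H P (fun ω => (A ω, B ω)) - H P B := by
  rw [condH_eq_sum, H_eq_sum, H_eq_sum, neg_sub_neg, ← Finset.sum_sub_distrib,
    ← Finset.sum_neg_distrib]
  refine Finset.sum_congr rfl fun ω _ => ?_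
  by_cases h : P ω = 0
  · simp [h]
  · rw [Real.logb_div (prob_pos hP (fun ω => (A ω, B ω)) h).ne' (prob_pos hP B h).ne']
    ring

theorem H_congr [Fintype α] [Fintype β] {P : Ω → ℝ} {A : Ω → α} {B : Ω → β}
    (h : ∀ ω ω', A ω' = A ω ↔ B ω' = B ω) : H P A = H P B := by
  simp only [H_eq_sum, fun ω => prob_congr (P := P) (h ω)]

theorem H_mono [Fintype α] [Fintype β] {P : Ω → ℝ} (hP : ∀ ω, 0 ≤ P ω) {A : Ω → α} {B : Ω → β}
    (h : ∀ ω ω', B ω' = B ω → A ω' = A ω) : H P A ≤ H P B := by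
  rw [H_eq_sum, H_eq_sum, neg_le_neg_iff]
  refine Finset.sum_le_sum fun ω _ => ?_
  by_cases h0 : P ω = 0
  · simp [h0]
  · exact mul_le_mul_of_nonneg_left (Real.logb_le_logb_of_le one_lt_two (prob_pos hP B h0)
      (prob_mono_fiber hP (h ω))) (hP ω)

/-- Gibbs' inequality: coding `A` given `B` with a mismatched (sub-)kernel `r` costs at least the
conditional entropy. -/
theorem condH_le_of_kernel [Fintype α] [Fintype β] {P : Ω → ℝ} (hP : ∀ ω, 0 ≤ P ω)
    (hP1 : ∑ ω, P ω = 1) (A : Ω → α) (B : Ω → β) (r : α → β → ℝ) (hr : ∀ a b, 0 ≤ r a b)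
    (hr1 : ∀ b, ∑ a, r a b ≤ 1) (hpos : ∀ ω, P ω ≠ 0 → 0 < r (A ω) (B ω)) :
    condH P A B ≤ - ∑ ω, P ω * Real.logb 2 (r (A ω) (B ω)) := by
  have hlog : (0 : ℝ) < Real.log 2 := Real.log_pos one_lt_two
  set p : Ω → ℝ := fun ω => prob P (fun ω => (A ω, B ω)) (A ω, B ω) with hp
  have key : ∀ ω, P ω * Real.logb 2 (r (A ω) (B ω)) - P ω * Real.logb 2 (p ω / prob P B (B ω))
      ≤ (P ω * (r (A ω) (B ω) * prob P B (B ω) / p ω) - P ω) / Real.log 2 := by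
    intro ω
    by_cases h0 : P ω = 0
    · simp [h0]
    have hr0 := hpos ω h0
    have hp0 : 0 < p ω := prob_pos hP (fun ω => (A ω, B ω)) h0
    have hb0 := prob_pos hP B h0
    have h1 : Real.log (r (A ω) (B ω) * prob P B (B ω) / p ω)
        ≤ r (A ω) (B ω) * prob P B (B ω) / p ω - 1 :=
      Real.log_le_sub_one_of_pos (by positivity)
    have h2 : Real.log (r (A ω) (B ω) * prob P B (B ω) / p ω) =
        Real.log (r (A ω) (B ω)) - Real.log (p ω / prob P B (B ω)) := by
      rw [Real.log_div (by positivity) hp0.ne', Real.log_mul hr0.ne' hb0.ne',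
        Real.log_div hp0.ne' hb0.ne']
      ring
    rw [← mul_sub, Real.logb, Real.logb, ← sub_div, ← h2, ← mul_div_assoc]
    refine div_le_div_of_nonneg_right ?_ hlog.le
    have := mul_le_mul_of_nonneg_left h1 (hP ω)
    linarith
  have hsum : ∑ ω, P ω * (r (A ω) (B ω) * prob P B (B ω) / p ω) ≤ 1 := by
    rw [← sum_prob_mul P (fun ω => (A ω, B ω)) fun c =>
      r c.1 c.2 * prob P B c.2 / prob P (fun ω => (A ω, B ω)) c, Fintype.sum_prod_type_right]
    calc _ ≤ ∑ b, ∑ a, r a b * prob P B b := by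
          refine Finset.sum_le_sum fun b _ => Finset.sum_le_sum fun a _ => ?_
          have h1 := prob_nonneg hP B b
          have h2 := hr a b
          rcases eq_or_ne (prob P (fun ω => (A ω, B ω)) (a, b)) 0 with h | h
          · rw [h, zero_mul]; positivity
          · rw [mul_div_cancel₀ _ h]
      _ ≤ ∑ b, prob P B b := by
          refine Finset.sum_le_sum fun b _ => ?_
          rw [← Finset.sum_mul]
          exact mul_le_of_le_one_left (prob_nonneg hP B b) (hr1 b)
      _ = 1 := by rw [sum_prob, hP1]
  have htot := Finset.sum_le_sum fun ω (_ : ω ∈ Finset.univ) => key ω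
  rw [Finset.sum_sub_distrib, ← Finset.sum_div, Finset.sum_sub_distrib, hP1] at htot
  have : (∑ ω, P ω * (r (A ω) (B ω) * prob P B (B ω) / p ω) - 1) / Real.log 2 ≤ 0 :=
    div_nonpos_of_nonpos_of_nonneg (by linarith) hlog.le
  rw [condH_eq_sum]
  linarith

theorem H_pair_le [Fintype α] [Fintype β] {P : Ω → ℝ} (hP : ∀ ω, 0 ≤ P ω)
    (hP1 : ∑ ω, P ω = 1) (A : Ω → α) (B : Ω → β) :
    H P (fun ω => (A ω, B ω)) ≤ H P A + H P B := by
  have h := condH_le_of_kernel hP hP1 A B (fun a _ => prob P A a) (fun a _ => prob_nonneg hP A a)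
    (fun _ => by rw [sum_prob, hP1]) (fun ω h => prob_pos hP A h)
  rw [← H_eq_sum, condH_eq_sub hP] at h
  linarith

theorem H_pair_eq_add [Fintype α] [Fintype β] {P : Ω → ℝ} (hP : ∀ ω, 0 ≤ P ω)
    (A : Ω → α) (B : Ω → β)
    (h : ∀ a b, prob P (fun ω => (A ω, B ω)) (a, b) = prob P A a * prob P B b) :
    H P (fun ω => (A ω, B ω)) = H P A + H P B := by
  rw [H_eq_sum, H_eq_sum, H_eq_sum, ← neg_add, ← Finset.sum_add_distrib]
  congr 1
  refine Finset.sum_congr rfl fun ω _ => ?_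
  by_cases h0 : P ω = 0
  · simp [h0]
  · rw [h, Real.logb_mul (prob_pos hP A h0).ne' (prob_pos hP B h0).ne', mul_add]

theorem condH_unit [Fintype α] {P : Ω → ℝ} (hP : ∀ ω, 0 ≤ P ω) (hP1 : ∑ ω, P ω = 1)
    (A : Ω → α) : condH P A (fun _ => ()) = H P A := by
  have h1 : H P (fun ω => (A ω, ())) = H P A := H_congr fun ω ω' => by simp
  have h2 : H P (fun _ : Ω => ()) = 0 := by simp [H, prob, hP1]
  rw [condH_eq_sub hP, h1, h2, sub_zero]

/-- Conditional entropies of sequences are at most the sum of those of the letters. -/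
theorem condH_pi_le {ι : Type*} [Fintype ι] [DecidableEq ι] [Fintype α] [Fintype β] {P : Ω → ℝ}
    (hP : ∀ ω, 0 ≤ P ω)
    (hP1 : ∑ ω, P ω = 1) (A : ι → Ω → α) (B : ι → Ω → β) :
    condH P (fun ω i => A i ω) (fun ω i => B i ω) ≤ ∑ i, condH P (A i) (B i) := by
  have hnn : ∀ i a b, 0 ≤ prob P (fun ω => (A i ω, B i ω)) (a, b) / prob P (B i) b :=
    fun i a b => div_nonneg (prob_nonneg hP _ _) (prob_nonneg hP _ _)
  have hpos : ∀ i ω, P ω ≠ 0 →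
      0 < prob P (fun ω => (A i ω, B i ω)) (A i ω, B i ω) / prob P (B i) (B i ω) :=
    fun i ω h => div_pos (prob_pos hP (fun ω => (A i ω, B i ω)) h) (prob_pos hP (B i) h)
  refine (condH_le_of_kernel hP hP1 (fun ω i => A i ω) (fun ω i => B i ω)
    (fun a b => ∏ i, (prob P (fun ω => (A i ω, B i ω)) (a i, b i) / prob P (B i) (b i)))
    (fun a b => Finset.prod_nonneg fun i _ => hnn i _ _) (fun b => ?_)
    (fun ω h => Finset.prod_pos fun i _ => hpos i ω h)).trans_eq ?_
  · rw [← Fintype.prod_sum (fun i a =>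
      prob P (fun ω => (A i ω, B i ω)) (a, b i) / prob P (B i) (b i))]
    refine Finset.prod_le_one (fun i _ => Finset.sum_nonneg fun a _ => hnn i _ _) fun i _ => ?_
    rw [← Finset.sum_div, sum_prob_pair]
    exact div_self_le_one _
  · simp only [condH_eq_sum]
    rw [Finset.sum_neg_distrib, Finset.sum_comm]
    congr 1
    refine Finset.sum_congr rfl fun ω _ => ?_
    by_cases h0 : P ω = 0
    · simp [h0]
    · rw [← Finset.mul_sum, Real.logb, Real.log_prod (fun i _ => (hpos i ω h0).ne'),
        Finset.sum_div]
      rfl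

/-- Fano's inequality, for the reconstruction `d B` of `A` from `B`. -/
theorem condH_le_fano [Fintype α] [DecidableEq α] [Nonempty α] [Fintype β] {P : Ω → ℝ}
    (hP : ∀ ω, 0 ≤ P ω) (hP1 : ∑ ω, P ω = 1) (A : Ω → α) (B : Ω → β) (d : β → α) {e : ℝ}
    (he : ∑ ω, P ω * (if d (B ω) = A ω then 0 else 1) ≤ e) :
    condH P A B ≤ 1 + e * Real.logb 2 (Fintype.card α) := by
  set N : ℝ := (Fintype.card α : ℝ) with hN
  have hN1 : 1 ≤ N := by rw [hN]; exact_mod_cast Fintype.card_pos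
  have hN0 : 0 < N := by linarith
  have hL : 0 ≤ Real.logb 2 N := Real.logb_nonneg one_lt_two hN1
  have hr0 : ∀ a b, (0 : ℝ) < if d b = a then 1 / 2 else 1 / (2 * N) := fun a b => by
    split_ifs <;> positivity
  refine (condH_le_of_kernel hP hP1 A B (fun a b => if d b = a then 1 / 2 else 1 / (2 * N))
    (fun a b => (hr0 a b).le) (fun b => ?_) (fun ω _ => hr0 _ _)).trans ?_
  · calc ∑ a, (if d b = a then (1 : ℝ) / 2 else 1 / (2 * N))
        ≤ ∑ a, ((if d b = a then 1 / 2 else 0) + 1 / (2 * N)) := by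
          refine Finset.sum_le_sum fun a _ => ?_
          split_ifs
          · have : (0 : ℝ) < 1 / (2 * N) := by positivity
            linarith
          · simp
      _ = 1 := by
          rw [Finset.sum_add_distrib]
          simp only [Finset.sum_ite_eq, Finset.mem_univ, if_true, Finset.sum_const,
            Finset.card_univ, nsmul_eq_mul, ← hN]
          field_simp
          norm_num
  · have hterm : ∀ ω, P ω * Real.logb 2 (if d (B ω) = A ω then 1 / 2 else 1 / (2 * N)) =
        -(P ω) - P ω * (if d (B ω) = A ω then 0 else 1) * Real.logb 2 N := by
      intro ω
      split_ifs
      · rw [one_div, Real.logb_inv, Real.logb_self_eq_one one_lt_two]; ring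
      · rw [one_div, Real.logb_inv, Real.logb_mul two_ne_zero hN0.ne',
          Real.logb_self_eq_one one_lt_two]
        ring
    rw [Finset.sum_congr rfl fun ω _ => hterm ω, Finset.sum_sub_distrib, Finset.sum_neg_distrib,
      hP1, ← Finset.sum_mul]
    have := mul_le_mul_of_nonneg_right he hL
    linarith

end FiniteEntropy

/-! ### Product distributions -/

/-- Exchanging some coordinates between two independent copies does not change their joint law:
`s x y` is the first copy after the exchange and `s y x` the second one. -/
theorem sum_sum_exchange {A : Type*} [Fintype A] (w : A → ℝ) (s : A → A → A)
    (hs : ∀ x y, s (s x y) (s y x) = x) (hw : ∀ x y, w (s x y) * w (s y x) = w x * w y)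
    (F : A → A → ℝ) :
    ∑ x, ∑ y, w x * w y * F (s x y) (s y x) = ∑ x, ∑ y, w x * w y * F x y := by
  rw [← Fintype.sum_prod_type', ← Fintype.sum_prod_type']
  let e : A × A ≃ A × A :=
    { toFun := fun z => (s z.1 z.2, s z.2 z.1)
      invFun := fun z => (s z.1 z.2, s z.2 z.1)
      left_inv := fun z => by simp [hs]
      right_inv := fun z => by simp [hs] }
  rw [← e.sum_comp (fun z : A × A => w z.1 * w z.2 * F z.1 z.2)]
  refine Finset.sum_congr rfl fun z _ => ?_
  simp only [e, Equiv.coe_fn_mk, hw]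

section ProductLaw

variable {X : Fin 3 → Type*}

theorem productLaw_nonneg {p : ∀ k, X k → ℝ} (hp : ∀ k x, 0 ≤ p k x) (x : ∀ k, X k) :
    0 ≤ productLaw p x :=
  Finset.prod_nonneg fun k _ => hp k _

variable [∀ k, Fintype (X k)]

theorem sum_productLaw (p : ∀ k, X k → ℝ) : ∑ x, productLaw p x = ∏ k, ∑ x, p k x :=
  (Fintype.prod_sum p).symm

theorem sum_productLaw_eq_one {p : ∀ k, X k → ℝ} (hp : ∀ k, p k ∈ stdSimplex ℝ (X k)) :
    ∑ x, productLaw p x = 1 := by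
  rw [sum_productLaw]
  exact Finset.prod_eq_one fun k _ => (hp k).2

/-- The tuple that agrees with `x` on `T` and with `y` off `T`. -/
def mixOn (T : Finset (Fin 3)) (x y : ∀ k, X k) : ∀ k, X k := fun k => if k ∈ T then x k else y k

theorem productLaw_exchange (p : ∀ k, X k → ℝ) (T : Finset (Fin 3))
    (F : (∀ k, X k) → (∀ k, X k) → ℝ) :
    ∑ x, ∑ y, productLaw p x * productLaw p y * F (mixOn T x y) (mixOn T y x) =
      ∑ x, ∑ y, productLaw p x * productLaw p y * F x y := by
  refine sum_sum_exchange _ _ (fun x y => ?_) (fun x y => ?_) F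
  · funext k; simp only [mixOn]; split_ifs <;> rfl
  · simp only [productLaw, ← Finset.prod_mul_distrib]
    refine Finset.prod_congr rfl fun k _ => ?_
    simp only [mixOn]; split_ifs
    · rfl
    · exact mul_comm _ _

/-- Functions of disjoint groups of independent inputs are independent. -/
theorem prob_pair_of_disjoint {α β : Type*} {p : ∀ k, X k → ℝ}
    (hp : ∑ x, productLaw p x = 1) (T : Finset (Fin 3)) {A : (∀ k, X k) → α} {B : (∀ k, X k) → β}
    (hA : ∀ x y, A (mixOn T x y) = A x) (hB : ∀ x y, B (mixOn T x y) = B y) (a : α) (b : β) :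
    FiniteEntropy.prob (productLaw p) (fun x => (A x, B x)) (a, b) =
      FiniteEntropy.prob (productLaw p) A a * FiniteEntropy.prob (productLaw p) B b := by
  classical
  have h := productLaw_exchange p T fun x _ => if A x = a ∧ B x = b then 1 else 0
  simp only [hA, hB] at h
  simp only [FiniteEntropy.prob_eq_sum_ite, Finset.sum_mul_sum, Prod.mk.injEq]
  have h2 : ∀ x, ∑ y, productLaw p x * productLaw p y * (if A x = a ∧ B x = b then (1 : ℝ) else 0)
      = productLaw p x * (if A x = a ∧ B x = b then 1 else 0) := fun x => by
    rw [← Finset.sum_mul, ← Finset.mul_sum, hp, mul_one]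
  simp only [h2] at h
  rw [← h]
  refine Finset.sum_congr rfl fun x _ => Finset.sum_congr rfl fun y _ => ?_
  by_cases h1 : A x = a <;> by_cases h2 : B y = b <;> simp [h1, h2]

theorem H_pair_of_disjoint {α β : Type*} [Fintype α] [Fintype β] {p : ∀ k, X k → ℝ}
    (hp0 : ∀ k x, 0 ≤ p k x)
    (hp : ∑ x, productLaw p x = 1) (T : Finset (Fin 3)) {A : (∀ k, X k) → α} {B : (∀ k, X k) → β}
    (hA : ∀ x y, A (mixOn T x y) = A x) (hB : ∀ x y, B (mixOn T x y) = B y) :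
    FiniteEntropy.H (productLaw p) (fun x => (A x, B x)) =
      FiniteEntropy.H (productLaw p) A + FiniteEntropy.H (productLaw p) B :=
  FiniteEntropy.H_pair_eq_add (productLaw_nonneg hp0) A B (prob_pair_of_disjoint hp T hA hB)

end ProductLaw

/-! ### Time sharing -/

namespace TimeSharedInput

open FiniteEntropy

variable {X : Fin 3 → Type*} [∀ k, Fintype (X k)] (p : TimeSharedInput X)

/-- The product law of the inputs given `Q = q`. -/
noncomputable def condLaw (q : Fin p.m) : (∀ k, X k) → ℝ := productLaw fun k => p.pX k q

theorem condLaw_nonneg (q : Fin p.m) (x : ∀ k, X k) : 0 ≤ p.condLaw q x :=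
  productLaw_nonneg (fun k => (p.pX_mem k q).1) x

theorem sum_condLaw (q : Fin p.m) : ∑ x, p.condLaw q x = 1 :=
  sum_productLaw_eq_one fun k => p.pX_mem k q

theorem law_apply (ω : Fin p.m × (∀ k, X k)) : p.law ω = p.pQ ω.1 * p.condLaw ω.1 ω.2 := rfl

theorem law_nonneg (ω : Fin p.m × (∀ k, X k)) : 0 ≤ p.law ω :=
  mul_nonneg (p.pQ_mem.1 _) (p.condLaw_nonneg _ _)

theorem sum_law : ∑ ω, p.law ω = 1 := by
  simp only [law_apply, Fintype.sum_prod_type, ← Finset.mul_sum, sum_condLaw, mul_one]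
  exact p.pQ_mem.2

theorem prob_law {β : Type*} (B : (∀ k, X k) → β) (b : β) (q : Fin p.m) :
    prob p.law (fun ω => (B ω.2, ω.1)) (b, q) = p.pQ q * prob (p.condLaw q) B b := by
  classical
  simp only [prob_eq_sum_ite, Fintype.sum_prod_type, law_apply, Prod.mk.injEq, Finset.mul_sum]
  rw [Finset.sum_eq_single q]
  · exact Finset.sum_congr rfl fun x _ => by simp
  · intro q' _ hq'
    simp [hq']
  · simp

/-- Conditioning on `Q` averages the conditional entropies of the letters. -/
theorem condH_law {α β : Type*} [Fintype α] [Fintype β] (A : (∀ k, X k) → α)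
    (B : (∀ k, X k) → β) :
    condH p.law (fun ω => A ω.2) (fun ω => (B ω.2, ω.1)) =
      ∑ q, p.pQ q * condH (p.condLaw q) A B := by
  simp only [condH_eq_sum, Fintype.sum_prod_type, mul_neg, Finset.sum_neg_distrib,
    Finset.mul_sum]
  congr 1
  refine Finset.sum_congr rfl fun q _ => Finset.sum_congr rfl fun x _ => ?_
  rw [law_apply, mul_assoc]
  by_cases hq : p.pQ q = 0
  · simp [hq]
  congr 3
  have h1 : prob p.law (fun ω => (A ω.2, (B ω.2, ω.1))) (A x, (B x, q)) =
      p.pQ q * prob (p.condLaw q) (fun x => (A x, B x)) (A x, B x) := by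
    rw [← p.prob_law (fun x => (A x, B x))]
    exact prob_congr fun ω => by simp [Prod.ext_iff, and_assoc]
  rw [h1, p.prob_law, mul_div_mul_left _ _ hq]

theorem condH_law_self {α : Type*} [Fintype α] (A : (∀ k, X k) → α) :
    condH p.law (fun ω => A ω.2) (fun ω => ω.1) = ∑ q, p.pQ q * H (p.condLaw q) A := by
  have h : condH p.law (fun ω => A ω.2) (fun ω => ω.1) =
      condH p.law (fun ω => A ω.2) (fun ω => ((fun _ => ()) ω.2, ω.1)) := by
    rw [condH_eq_sub p.law_nonneg, condH_eq_sub p.law_nonneg]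
    congr 1 <;> exact H_congr fun ω ω' => by simp [Prod.ext_iff]
  rw [h, p.condH_law A fun _ => ()]
  exact Finset.sum_congr rfl fun q _ => by
    rw [condH_unit (p.condLaw_nonneg q) (p.sum_condLaw q)]

end TimeSharedInput

/-! ### The bounds on the rates as one vector -/

/-- The rate sums that are bounded at receiver `k`: all rates for `(k, none)`, the rate `R k` for
`(k, some k)`, and all rates but `R l` for `(k, some l)` with `l ≠ k`. -/
def rateSum (R : Fin 3 → ℝ) : Fin 3 × Option (Fin 3) → ℝ
  | (_, none) => ∑ l, R l
  | (k, some l) => if l = k then R k else ∑ j, R j - R l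

namespace DIC3

open FiniteEntropy

variable {X : Fin 3 → Type*} {V : Fin 3 → Fin 3 → Type*} {S Y : Fin 3 → Type*}
  [∀ k, Fintype (X k)] [∀ l k, Fintype (V l k)] [∀ k, Fintype (Y k)]

/-- The entropies `H(Y_k)`, `H(X_{kk})` and `H(Y_k | X_{lk})` for a given law of the inputs,
indexed as in `rateSum`. -/
noncomputable def letterBound (C : DIC3 X V S Y) (P : (∀ k, X k) → ℝ) :
    Fin 3 × Option (Fin 3) → ℝ
  | (k, none) => H P (C.output k)
  | (k, some l) => if l = k then H P (C.link k k) else condH P (C.output k) (C.link l k)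

/-- The entropies `H(Y_k | Q)`, `H(X_{kk} | Q)` and `H(Y_k | X_{lk}, Q)`, indexed as in
`rateSum`. -/
noncomputable def sharedBound (C : DIC3 X V S Y) (p : TimeSharedInput X) :
    Fin 3 × Option (Fin 3) → ℝ
  | (k, none) => C.HY p k
  | (k, some l) => if l = k then C.HX p k else C.HYX p k l

theorem sharedBound_eq_sum (C : DIC3 X V S Y) (p : TimeSharedInput X) :
    C.sharedBound p = ∑ q, p.pQ q • C.letterBound (p.condLaw q) := by
  funext ⟨k, o⟩
  rw [Finset.sum_apply]
  simp only [Pi.smul_apply, smul_eq_mul]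
  rcases o with _ | l
  · exact p.condH_law_self _
  · by_cases h : l = k
    · simp only [sharedBound, letterBound, h, if_true]
      exact p.condH_law_self _
    · simp only [sharedBound, letterBound, h, if_false]
      exact p.condH_law _ _

theorem mem_strictRegion_iff (C : DIC3 X V S Y) (R : Fin 3 → ℝ) :
    R ∈ C.strictRegion ↔ (∀ k, 0 ≤ R k) ∧
      ∃ p : TimeSharedInput X, ∀ j, rateSum R j < C.sharedBound p j := by
  refine and_congr_right fun _ => exists_congr fun p => ?_
  simp only [Prod.forall, Option.forall, Fin.forall_fin_succ, rateSum, sharedBound, lt_min_iff,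
    Fin.sum_univ_three]
  simp
  constructor
  · rintro ⟨⟨h1, h2, h3⟩, ⟨h4, h5⟩, ⟨h6, h7⟩, ⟨h8, h9⟩, h10, h11, h12⟩
    refine ⟨⟨?_, ?_, ?_, ?_⟩, ⟨?_, ?_, ?_, ?_⟩, ?_, ?_, ?_, ?_⟩ <;> linarith
  · rintro ⟨⟨h1, h2, h3, h4⟩, ⟨h5, h6, h7, h8⟩, h9, h10, h11, h12⟩
    refine ⟨⟨?_, ?_, ?_⟩, ⟨?_, ?_⟩, ⟨?_, ?_⟩, ⟨?_, ?_⟩, ?_, ?_, ?_⟩ <;> linarith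

theorem mem_closedRegion_iff (C : DIC3 X V S Y) (R : Fin 3 → ℝ) :
    R ∈ C.closedRegion ↔ (∀ k, 0 ≤ R k) ∧
      ∃ p : TimeSharedInput X, rateSum R ≤ C.sharedBound p := by
  refine and_congr_right fun _ => exists_congr fun p => ?_
  simp only [Pi.le_def, Prod.forall, Option.forall, Fin.forall_fin_succ, rateSum, sharedBound,
    le_min_iff, Fin.sum_univ_three]
  simp
  constructor
  · rintro ⟨⟨h1, h2, h3⟩, ⟨h4, h5⟩, ⟨h6, h7⟩, ⟨h8, h9⟩, h10, h11, h12⟩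
    refine ⟨⟨?_, ?_, ?_, ?_⟩, ⟨?_, ?_, ?_, ?_⟩, ?_, ?_, ?_, ?_⟩ <;> linarith
  · rintro ⟨⟨h1, h2, h3, h4⟩, ⟨h5, h6, h7, h8⟩, h9, h10, h11, h12⟩
    refine ⟨⟨?_, ?_, ?_⟩, ⟨?_, ?_⟩, ⟨?_, ?_⟩, ⟨?_, ?_⟩, ?_, ?_, ?_⟩ <;> linarith

end DIC3

/-! ### Compactness of the time-sharing region -/

/-- In finite dimensions, the convex hull of a compact set is compact, by Carathéodory's theorem. -/
theorem IsCompact.convexHull_of_finiteDimensional {E : Type*} [NormedAddCommGroup E]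
    [NormedSpace ℝ E] [FiniteDimensional ℝ E] {s : Set E} (hs : IsCompact s) :
    IsCompact (convexHull ℝ s) := by
  set d := Module.finrank ℝ E + 1
  let F : ∀ m : ℕ, (Fin m → ℝ) × (Fin m → E) → E := fun m z => ∑ i, z.1 i • z.2 i
  have hunion : convexHull ℝ s = ⋃ m ∈ Finset.range (d + 1),
      F m '' (stdSimplex ℝ (Fin m) ×ˢ Set.univ.pi fun _ => s) := by
    refine Set.Subset.antisymm (fun x hx => ?_) ?_
    · obtain ⟨ι, _, z, w, hz, haff, hw, hw1, hx⟩ := eq_pos_convex_span_of_mem_convexHull hx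
      have hcard : Fintype.card ι ≤ d :=
        haff.card_le_finrank_succ.trans (Nat.succ_le_succ (Submodule.finrank_le _))
      let e := Fintype.equivFin ι
      simp only [Set.mem_iUnion]
      refine ⟨Fintype.card ι, by simpa [Nat.lt_succ_iff] using hcard,
        (w ∘ e.symm, z ∘ e.symm), ⟨⟨fun i => (hw _).le, ?_⟩, fun i _ => hz ⟨_, rfl⟩⟩, ?_⟩
      · rw [← hw1]; exact e.symm.sum_comp w
      · rw [← hx]; exact e.symm.sum_comp fun i => w i • z i
    · simp only [Set.iUnion_subset_iff]
      rintro m - _ ⟨⟨w, z⟩, ⟨hw, hz⟩, rfl⟩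
      exact mem_convexHull_of_exists_fintype w z hw.1 hw.2 (fun i => hz i (Set.mem_univ i)) rfl
  rw [hunion]
  refine (Finset.range (d + 1)).isCompact_biUnion fun m _ => ?_
  refine ((isCompact_stdSimplex ℝ (Fin m)).prod (isCompact_univ_pi fun _ => hs)).image ?_
  fun_prop

namespace FiniteEntropy

theorem continuous_H {Ω α : Type*} [Fintype Ω] [Fintype α] (A : Ω → α) :
    Continuous fun P : Ω → ℝ => H P A := by
  have h : ∀ P : Ω → ℝ, H P A = ∑ a, Real.negMulLog (prob P A a) / Real.log 2 := fun P => by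
    simp only [H, Real.negMulLog, Real.logb, ← Finset.sum_neg_distrib]
    exact Finset.sum_congr rfl fun a _ => by ring
  simp only [h]
  have hp : ∀ a, Continuous fun P : Ω → ℝ => prob P A a := fun a => by unfold prob; fun_prop
  exact continuous_finsetSum _ fun a _ => (Real.continuous_negMulLog.comp (hp a)).div_const _

end FiniteEntropy

namespace DIC3

open FiniteEntropy

variable {X : Fin 3 → Type*} {V : Fin 3 → Fin 3 → Type*} {S Y : Fin 3 → Type*}
  [∀ k, Fintype (X k)] [∀ l k, Fintype (V l k)] [∀ k, Fintype (Y k)]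

/-- The entropy vectors of all product input laws, without time sharing. -/
noncomputable def letterSet (C : DIC3 X V S Y) : Set (Fin 3 × Option (Fin 3) → ℝ) :=
  (fun p => C.letterBound (productLaw p)) '' Set.univ.pi fun k => stdSimplex ℝ (X k)

theorem isCompact_letterSet (C : DIC3 X V S Y) : IsCompact C.letterSet := by
  refine (isCompact_univ_pi fun k => isCompact_stdSimplex ℝ (X k)).image_of_continuousOn ?_
  have hlaw : Continuous fun p : ∀ k, X k → ℝ => productLaw p :=
    continuous_pi fun x => by unfold productLaw; fun_prop
  rw [continuousOn_pi]
  rintro ⟨k, _ | l⟩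
  · exact ((continuous_H _).comp hlaw).continuousOn
  · simp only [letterBound]
    split_ifs
    · exact ((continuous_H _).comp hlaw).continuousOn
    · refine ContinuousOn.congr
        (((continuous_H _).comp hlaw).sub ((continuous_H _).comp hlaw)).continuousOn
        fun p hp => condH_eq_sub (productLaw_nonneg fun k => (hp k (Set.mem_univ k)).1) _ _

theorem mem_convexHull_letterSet_iff (C : DIC3 X V S Y) (v : Fin 3 × Option (Fin 3) → ℝ) :
    v ∈ convexHull ℝ C.letterSet ↔ ∃ p : TimeSharedInput X, C.sharedBound p = v := by
  constructor
  · intro hv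
    obtain ⟨ι, _, w, z, hw, hw1, hz, hv⟩ := mem_convexHull_iff_exists_fintype.1 hv
    choose p hp hpz using hz
    let e := Fintype.equivFin ι
    refine ⟨⟨Fintype.card ι, w ∘ e.symm, ⟨fun i => hw _, ?_⟩, fun k i => p (e.symm i) k,
      fun k i => hp (e.symm i) k (Set.mem_univ k)⟩, ?_⟩
    · rw [← hw1]; exact e.symm.sum_comp w
    · rw [sharedBound_eq_sum, ← hv]
      refine Eq.trans ?_ (e.symm.sum_comp fun i => w i • z i)
      exact Finset.sum_congr rfl fun i _ => by rw [← hpz]; rfl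
  · rintro ⟨p, rfl⟩
    rw [sharedBound_eq_sum]
    exact mem_convexHull_of_exists_fintype p.pQ _ p.pQ_mem.1 p.pQ_mem.2
      (fun q => ⟨fun k => p.pX k q, fun k _ => p.pX_mem k q, rfl⟩) rfl

theorem mem_closedRegion_iff_lowerClosure (C : DIC3 X V S Y) (R : Fin 3 → ℝ) :
    R ∈ C.closedRegion ↔ (∀ k, 0 ≤ R k) ∧
      rateSum R ∈ lowerClosure (convexHull ℝ C.letterSet) := by
  rw [mem_closedRegion_iff]
  refine and_congr_right fun _ => ?_
  simp only [mem_lowerClosure, mem_convexHull_letterSet_iff]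
  exact ⟨fun ⟨p, hp⟩ => ⟨_, ⟨p, rfl⟩, hp⟩, fun ⟨_, ⟨p, hp⟩, h⟩ => ⟨p, hp ▸ h⟩⟩

theorem isClosed_lowerClosure_letterSet (C : DIC3 X V S Y) :
    IsClosed (lowerClosure (convexHull ℝ C.letterSet) : Set (Fin 3 × Option (Fin 3) → ℝ)) := by
  have h := C.isCompact_letterSet.convexHull_of_finiteDimensional
  exact h.isClosed.lowerClosure_pi h.isBounded.bddAbove

theorem continuous_rateSum : Continuous rateSum := by
  refine continuous_pi ?_
  rintro ⟨k, _ | l⟩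
  · simp only [rateSum]; fun_prop
  · simp only [rateSum]; split_ifs <;> fun_prop

theorem isClosed_closedRegion (C : DIC3 X V S Y) : IsClosed C.closedRegion := by
  have h : C.closedRegion = {R | ∀ k, 0 ≤ R k} ∩ rateSum ⁻¹'
      (lowerClosure (convexHull ℝ C.letterSet) : Set (Fin 3 × Option (Fin 3) → ℝ)) :=
    Set.ext fun R => C.mem_closedRegion_iff_lowerClosure R
  rw [h]
  refine IsClosed.inter ?_ (C.isClosed_lowerClosure_letterSet.preimage continuous_rateSum)
  simp only [Set.ofPred_forall]
  exact isClosed_iInter fun k => isClosed_le continuous_const (continuous_apply k)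

/-- A rate triple that satisfies the bounds up to every `ε > 0`, with inputs that may depend on `ε`,
lies in the region. -/
theorem mem_closedRegion_of_slack (C : DIC3 X V S Y) {R : Fin 3 → ℝ} (hR : ∀ k, 0 ≤ R k)
    (h : ∀ ε > 0, ∃ p : TimeSharedInput X, ∀ j, rateSum R j - ε ≤ C.sharedBound p j) :
    R ∈ C.closedRegion := by
  rw [mem_closedRegion_iff_lowerClosure]
  refine ⟨hR, ?_⟩
  have hmem : ∀ n : ℕ, (fun j => rateSum R j - 1 / ((n : ℝ) + 1)) ∈
      (lowerClosure (convexHull ℝ C.letterSet) : Set (Fin 3 × Option (Fin 3) → ℝ)) := fun n => by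
    obtain ⟨p, hp⟩ := h (1 / ((n : ℝ) + 1)) (by positivity)
    exact ⟨_, (C.mem_convexHull_letterSet_iff _).2 ⟨p, rfl⟩, hp⟩
  refine C.isClosed_lowerClosure_letterSet.mem_of_tendsto (tendsto_pi_nhds.2 fun j => ?_)
    (Filter.Eventually.of_forall (f := Filter.atTop) hmem)
  simpa using (tendsto_const_nhds (x := rateSum R j)).sub
    (tendsto_one_div_add_atTop_nhds_zero_nat (𝕜 := ℝ))

end DIC3

/-! ### Consequences of strong interference and invertibility -/

namespace FiniteEntropy

variable {Ω α β : Type*} [Fintype Ω]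

/-- If `B` determines `A` on the support of `P` and has no more entropy than `A`, then conversely
`A` determines `B`. -/
theorem eq_of_H_le [Fintype α] [Fintype β] {P : Ω → ℝ} (hP : ∀ ω, 0 ≤ P ω) {A : Ω → α} {B : Ω → β}
    (hBA : ∀ ω ω', P ω ≠ 0 → P ω' ≠ 0 → B ω' = B ω → A ω' = A ω) (hH : H P B ≤ H P A)
    {ω ω' : Ω} (hω : P ω ≠ 0) (hω' : P ω' ≠ 0) (hA : A ω' = A ω) : B ω' = B ω := by
  classical
  have hterm : ∀ ω₀, P ω₀ ≠ 0 → ∀ ω₁,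
      P ω₁ * (if B ω₁ = B ω₀ then 1 else 0) ≤ P ω₁ * (if A ω₁ = A ω₀ then 1 else 0) := by
    intro ω₀ h0 ω₁
    by_cases h1 : P ω₁ = 0
    · simp [h1]
    by_cases hB : B ω₁ = B ω₀
    · simp [hB, hBA ω₀ ω₁ h0 h1 hB]
    · simp only [hB, if_false, mul_zero]
      exact mul_nonneg (hP _) (by split_ifs <;> norm_num)
  have hle : ∀ ω₀, P ω₀ ≠ 0 → prob P B (B ω₀) ≤ prob P A (A ω₀) := fun ω₀ h0 => by
    simp only [prob_eq_sum_ite]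
    exact Finset.sum_le_sum fun ω₁ _ => hterm ω₀ h0 ω₁
  have hlog : ∀ ω₀ ∈ Finset.univ, P ω₀ * Real.logb 2 (prob P B (B ω₀)) ≤
      P ω₀ * Real.logb 2 (prob P A (A ω₀)) := fun ω₀ _ => by
    by_cases h0 : P ω₀ = 0
    · simp [h0]
    · exact mul_le_mul_of_nonneg_left
        (Real.logb_le_logb_of_le one_lt_two (prob_pos hP B h0) (hle ω₀ h0)) (hP ω₀)
  rw [H_eq_sum, H_eq_sum, neg_le_neg_iff] at hH
  have heq := (Finset.sum_eq_sum_iff_of_le hlog).1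
    (le_antisymm (Finset.sum_le_sum hlog) hH) ω (Finset.mem_univ _)
  have hprob := Real.logb_injOn_pos one_lt_two (prob_pos hP B hω) (prob_pos hP A hω)
    (mul_left_cancel₀ hω heq)
  by_contra hB
  refine hprob.not_lt ?_
  simp only [prob_eq_sum_ite]
  refine Finset.sum_lt_sum (fun ω₁ _ => hterm ω hω ω₁) ⟨ω', Finset.mem_univ _, ?_⟩
  simpa [hB, hA] using lt_of_le_of_ne (hP ω') hω'.symm

theorem prob_prob {Z : Type*} [Fintype Z] (P : Ω → ℝ) (z : Ω → Z) (A : Z → α) (a : α) :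
    prob (prob P z) A a = prob P (fun ω => A (z ω)) a := by
  classical
  rw [prob_eq_sum_ite, sum_prob_mul P z fun x => if A x = a then 1 else 0, prob_eq_sum_ite]

theorem H_prob {Z : Type*} [Fintype Z] [Fintype α] (P : Ω → ℝ) (z : Ω → Z) (A : Z → α) :
    H (prob P z) A = H P fun ω => A (z ω) := by
  simp only [H, prob_prob]

theorem condH_prob {Z : Type*} [Fintype Z] [Fintype α] [Fintype β] (P : Ω → ℝ) (z : Ω → Z)
    (A : Z → α) (B : Z → β) :
    condH (prob P z) A B = condH P (fun ω => A (z ω)) fun ω => B (z ω) := by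
  simp only [condH, prob_prob, prob_prob P z fun x => (A x, B x)]

theorem H_pi_le {ι : Type*} [Fintype ι] [DecidableEq ι] [Fintype α] {P : Ω → ℝ}
    (hP : ∀ ω, 0 ≤ P ω) (hP1 : ∑ ω, P ω = 1) (A : ι → Ω → α) :
    H P (fun ω i => A i ω) ≤ ∑ i, H P (A i) := by
  have h := condH_pi_le hP hP1 A fun _ _ => ()
  simp only [condH_unit hP hP1] at h
  have h1 : condH P (fun ω i => A i ω) (fun _ (_ : ι) => ()) =
      condH P (fun ω i => A i ω) (fun _ => ()) := by
    rw [condH_eq_sub hP, condH_eq_sub hP]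
    congr 1 <;> exact H_congr fun ω ω' => by simp
  rwa [h1, condH_unit hP hP1] at h

end FiniteEntropy

/-- A function of one coordinate, averaged over a product distribution. -/
theorem sum_prod_mul_apply {ι : Type*} [Fintype ι] [DecidableEq ι] {α : ι → Type*}
    [∀ i, Fintype (α i)] {p : ∀ i, α i → ℝ} (hp : ∀ i, ∑ a, p i a = 1) (i : ι) (G : α i → ℝ) :
    ∑ x : ∀ i, α i, (∏ j, p j (x j)) * G (x i) = ∑ a, p i a * G a := by
  let p' : ∀ i, α i → ℝ := Function.update p i fun a => p i a * G a
  have hp' : ∀ x : ∀ i, α i, (∏ j, p j (x j)) * G (x i) = ∏ j, p' j (x j) := fun x => by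
    rw [← Finset.mul_prod_erase Finset.univ _ (Finset.mem_univ i),
      ← Finset.mul_prod_erase Finset.univ (fun j => p' j (x j)) (Finset.mem_univ i)]
    have h2 : ∏ j ∈ Finset.univ.erase i, p' j (x j) = ∏ j ∈ Finset.univ.erase i, p j (x j) :=
      Finset.prod_congr rfl fun j hj => by
        simp [p', Function.update_of_ne (Finset.ne_of_mem_erase hj)]
    rw [h2]
    simp only [p', Function.update_self]
    ring
  simp only [hp']
  rw [← Fintype.prod_sum, ← Finset.mul_prod_erase Finset.univ _ (Finset.mem_univ i),
    Finset.prod_eq_one, mul_one]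
  · simp [p']
  · intro j hj
    simp [p', Function.update_of_ne (Finset.ne_of_mem_erase hj), hp]

theorem prob_productLaw {X : Fin 3 → Type*} [∀ k, Fintype (X k)] {p : ∀ k, X k → ℝ}
    (hp : ∀ k, ∑ x, p k x = 1) (k : Fin 3) {α : Type*} (A : X k → α) (a : α) :
    FiniteEntropy.prob (productLaw p) (fun x => A (x k)) a = FiniteEntropy.prob (p k) A a := by
  classical
  simp only [FiniteEntropy.prob_eq_sum_ite]
  exact sum_prod_mul_apply hp k fun x => if A x = a then 1 else 0

/-- The uniform distribution on a finite type. -/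
noncomputable def uniformPMF (α : Type*) [Fintype α] : α → ℝ := fun _ => (Fintype.card α : ℝ)⁻¹

theorem uniformPMF_pos {α : Type*} [Fintype α] [Nonempty α] (a : α) : 0 < uniformPMF α a :=
  inv_pos.2 (by exact_mod_cast Fintype.card_pos)

theorem uniformPMF_mem {α : Type*} [Fintype α] [Nonempty α] : uniformPMF α ∈ stdSimplex ℝ α := by
  refine ⟨fun a => (uniformPMF_pos a).le, ?_⟩
  have : (Fintype.card α : ℝ) ≠ 0 := by exact_mod_cast Fintype.card_ne_zero
  simp [uniformPMF, this]

theorem intfA_ne (k : Fin 3) : intfA k ≠ k := by fin_cases k <;> decide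
theorem intfB_ne (k : Fin 3) : intfB k ≠ k := by fin_cases k <;> decide
theorem intfA_ne_intfB (k : Fin 3) : intfA k ≠ intfB k := by fin_cases k <;> decide

namespace DIC3

open FiniteEntropy

variable {X : Fin 3 → Type*} {V : Fin 3 → Fin 3 → Type*} {S Y : Fin 3 → Type*}
  [∀ k, Fintype (X k)] [∀ k, Nonempty (X k)] [∀ l k, Fintype (V l k)]

/-- Under strong interference, the signal on a cross link determines the signal on the direct
link: for an input that is uniform on two letters with the same cross signal, the entropies of both
signals vanish. -/
theorem StrongInterference.direct_eq {C : DIC3 X V S Y} (h : C.StrongInterference) {l k : Fin 3}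
    (hkl : k ≠ l) {x x' : X l} (hx : C.g l k x' = C.g l k x) : C.g l l x' = C.g l l x := by
  classical
  -- the two halves add up to `1` if `x = x'`, so that no case distinction is needed
  let u : X l → ℝ := fun a => (if a = x then 1 / 2 else 0) + if a = x' then 1 / 2 else 0
  have hu : u ∈ stdSimplex ℝ (X l) := by
    refine ⟨fun a => ?_, ?_⟩
    · simp only [u]; split_ifs <;> norm_num
    · simp only [u, Finset.sum_add_distrib, Finset.sum_ite_eq', Finset.mem_univ, if_true]
      norm_num
  let p : ∀ j, X j → ℝ := Function.update (fun j => uniformPMF (X j)) l u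
  have hp : ∀ j, p j ∈ stdSimplex ℝ (X j) := fun j => by
    by_cases hj : j = l
    · subst hj; simpa [p] using hu
    · simpa [p, hj] using uniformPMF_mem
  have hpl : p l = u := Function.update_self ..
  have hsupp : ∀ y, productLaw p y ≠ 0 → C.link l k y = C.g l k x := fun y hy => by
    have h1 := Finset.prod_ne_zero_iff.1 hy l (Finset.mem_univ _)
    rw [hpl] at h1
    by_cases hyx : y l = x
    · rw [link, hyx]
    · by_cases hyx' : y l = x'
      · rw [link, hyx', hx]
      · simp [u, hyx, hyx'] at h1
  let y : X l → ∀ j, X j := fun a => Function.update (fun j => Classical.arbitrary (X j)) l a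
  have hy : ∀ a, u a ≠ 0 → productLaw p (y a) ≠ 0 := fun a ha => by
    refine Finset.prod_ne_zero_iff.2 fun j _ => ?_
    by_cases hj : j = l
    · subst hj; simpa [p, y] using ha
    · simpa [p, hj] using (uniformPMF_pos _).ne'
  have hux : u x ≠ 0 := by simp only [u, if_true]; split_ifs <;> norm_num
  have hux' : u x' ≠ 0 := by simp only [u, if_true]; split_ifs <;> norm_num
  have := eq_of_H_le (A := C.link l k) (B := C.link l l)
    (productLaw_nonneg fun j => (hp j).1)
    (fun ω ω' h1 h2 _ => (hsupp ω' h2).trans (hsupp ω h1).symm) (h p hp l k hkl)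
    (hy x hux) (hy x' hux') ((hsupp _ (hy x' hux')).trans (hsupp _ (hy x hux)).symm)
  simpa [link, y] using this

/-- Under invertibility, the combined interference determines both interfering signals. -/
theorem InvertibleCombining.links_eq [∀ k, Fintype (S k)] {C : DIC3 X V S Y}
    (h : C.InvertibleCombining) {k : Fin 3} {x x' : ∀ j, X j} (hx : C.intf k x' = C.intf k x) :
    C.link (intfA k) k x' = C.link (intfA k) k x ∧
      C.link (intfB k) k x' = C.link (intfB k) k x := by
  have hp : ∀ j, uniformPMF (X j) ∈ stdSimplex ℝ (X j) := fun j => uniformPMF_mem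
  have hpos : ∀ y, productLaw (fun j => uniformPMF (X j)) y ≠ 0 := fun y =>
    (Finset.prod_pos fun j _ => uniformPMF_pos _).ne'
  have hsum := H_pair_of_disjoint (fun j => (hp j).1) (sum_productLaw_eq_one hp) {intfA k}
    (A := C.link (intfA k) k) (B := C.link (intfB k) k)
    (fun x y => by simp [link, mixOn])
    (fun x y => by simp [link, mixOn, (intfA_ne_intfB k).symm])
  rw [← h _ hp k] at hsum
  have := eq_of_H_le (A := C.intf k) (B := fun x => (C.link (intfA k) k x, C.link (intfB k) k x))
    (productLaw_nonneg fun j => (hp j).1)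
    (fun ω ω' _ _ h => by simp only [Prod.mk.injEq] at h; simp only [intf, h.1, h.2])
    hsum.le (hpos x) (hpos x') hx
  simpa using this

end DIC3

/-! ### Converse -/

theorem rateSum_mono {R R' : Fin 3 → ℝ} (h : ∀ k, R k ≤ R' k) (j : Fin 3 × Option (Fin 3)) :
    rateSum R j ≤ rateSum R' j := by
  have h0 := h 0
  have h1 := h 1
  have h2 := h 2
  obtain ⟨k, _ | l⟩ := j
  · simp only [rateSum, Fin.sum_univ_three]; linarith
  · simp only [rateSum, Fin.sum_univ_three]
    split_ifs
    · exact h k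
    · fin_cases l <;> simp <;> linarith

theorem rateSum_mul (a : ℝ) (R : Fin 3 → ℝ) (j : Fin 3 × Option (Fin 3)) :
    rateSum (fun k => a * R k) j = a * rateSum R j := by
  obtain ⟨k, _ | l⟩ := j
  · simp only [rateSum, Finset.mul_sum]
  · simp only [rateSum, ← Finset.mul_sum]
    split_ifs <;> ring

namespace DIC3Code

open FiniteEntropy

variable {X Y : Fin 3 → Type*} {n : ℕ} {M : Fin 3 → ℕ}

/-- The inputs at time `i` as a function of the messages. -/
def input (c : DIC3Code X Y n M) (i : Fin n) (w : ∀ k, Fin (M k)) : ∀ k, X k :=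
  fun k => c.enc k (w k) i

variable [∀ k, Fintype (X k)] [∀ k, Nonempty (Fin (M k))]

/-- The law of uniform independent messages. -/
noncomputable def msgLaw (M : Fin 3 → ℕ) : (∀ k, Fin (M k)) → ℝ :=
  productLaw fun k => uniformPMF (Fin (M k))

theorem msgLaw_nonneg (w : ∀ k, Fin (M k)) : 0 ≤ msgLaw M w :=
  productLaw_nonneg (fun _ => (uniformPMF_mem).1) w

theorem sum_msgLaw : ∑ w, msgLaw M w = 1 := sum_productLaw_eq_one fun _ => uniformPMF_mem

theorem msgLaw_apply (w : ∀ k, Fin (M k)) :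
    msgLaw M w = (Fintype.card (∀ k, Fin (M k)) : ℝ)⁻¹ := by
  simp [msgLaw, productLaw, uniformPMF, Fintype.card_pi]

theorem H_msg (k : Fin 3) : H (msgLaw M) (fun w => w k) = Real.logb 2 (M k) := by
  have h : ∀ a, prob (msgLaw M) (fun w => w k) a = (M k : ℝ)⁻¹ := fun a => by
    refine (prob_productLaw (X := fun k => Fin (M k)) (fun k => uniformPMF_mem.2) k
      (fun a => a) a).trans ?_
    simp [prob_eq_sum_ite, uniformPMF]
  rw [H_eq_sum]
  simp only [h, ← Finset.sum_mul, sum_msgLaw, Real.logb_inv]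
  ring

theorem H_pair_msgLaw {α β : Type*} [Fintype α] [Fintype β] (T : Finset (Fin 3))
    {A : (∀ k, Fin (M k)) → α} {B : (∀ k, Fin (M k)) → β}
    (hA : ∀ x y, A (mixOn T x y) = A x) (hB : ∀ x y, B (mixOn T x y) = B y) :
    H (msgLaw M) (fun x => (A x, B x)) = H (msgLaw M) A + H (msgLaw M) B :=
  H_pair_of_disjoint (fun _ => (uniformPMF_mem).1) sum_msgLaw T hA hB

/-- The empirical input of a code: `Q` is a uniform time index, and the inputs given `Q = i` are
those at time `i` for uniform messages. -/
noncomputable def empiricalInput [Nonempty (Fin n)] (c : DIC3Code X Y n M) : TimeSharedInput X where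
  m := n
  pQ := uniformPMF (Fin n)
  pQ_mem := uniformPMF_mem
  pX k i := prob (uniformPMF (Fin (M k))) fun w => c.enc k w i
  pX_mem k i := ⟨prob_nonneg uniformPMF_mem.1 _, by rw [sum_prob]; exact uniformPMF_mem.2⟩

theorem condLaw_empiricalInput [Nonempty (Fin n)] (c : DIC3Code X Y n M) (i : Fin n) :
    c.empiricalInput.condLaw i = prob (msgLaw M) (c.input i) := by
  classical
  funext x
  simp only [TimeSharedInput.condLaw, empiricalInput, productLaw, prob_eq_sum_ite, msgLaw]
  rw [Fintype.prod_sum]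
  refine Finset.sum_congr rfl fun w _ => ?_
  rw [Finset.prod_mul_distrib]
  congr 1
  rw [Finset.prod_ite_zero]
  simp [funext_iff, input]

end DIC3Code

namespace DIC3

open FiniteEntropy DIC3Code

variable {X : Fin 3 → Type*} {V : Fin 3 → Fin 3 → Type*} {S Y : Fin 3 → Type*}

theorem link_mixOn_of_mem (C : DIC3 X V S Y) {T : Finset (Fin 3)} {l : Fin 3} (h : l ∈ T)
    (k : Fin 3) (x y : ∀ j, X j) : C.link l k (mixOn T x y) = C.link l k x := by
  simp [link, mixOn, h]

theorem link_mixOn_of_notMem (C : DIC3 X V S Y) {T : Finset (Fin 3)} {l : Fin 3} (h : l ∉ T)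
    (k : Fin 3) (x y : ∀ j, X j) : C.link l k (mixOn T x y) = C.link l k y := by
  simp [link, mixOn, h]

variable [∀ k, Fintype (X k)] [∀ l k, Fintype (V l k)] [∀ k, Fintype (S k)] [∀ k, Fintype (Y k)]
  {n : ℕ} {M : Fin 3 → ℕ} [∀ k, Nonempty (Fin (M k))]

theorem input_mixOn (c : DIC3Code X Y n M) (i : Fin n) (T : Finset (Fin 3))
    (w w' : ∀ k, Fin (M k)) : c.input i (mixOn T w w') = mixOn T (c.input i w) (c.input i w') := by
  funext k
  simp only [input, mixOn]
  split_ifs <;> rfl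

/-- Fano's inequality at receiver `k`. Given its own message, the output is equivalent to the
combined interference, which is independent of that message. -/
theorem fano_receiver (C : DIC3 X V S Y) (c : DIC3Code X Y n M) (k : Fin 3) :
    Real.logb 2 (M k) + H (msgLaw M) (fun w i => C.intf k (c.input i w)) ≤
      H (msgLaw M) (fun w i => C.output k (c.input i w)) +
        (1 + C.errorProb c * Real.logb 2 (M k)) := by
  classical
  have he : ∑ w, msgLaw M w *
      (if c.dec k (fun i => C.output k (c.input i w)) = w k then 0 else 1) ≤ C.errorProb c := by
    simp only [msgLaw_apply, ← Finset.mul_sum]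
    rw [errorProb, div_eq_inv_mul]
    refine mul_le_mul_of_nonneg_left ?_ (by positivity)
    rw [Finset.card_filter, Nat.cast_sum]
    refine Finset.sum_le_sum fun w _ => ?_
    by_cases h : c.dec k (fun i => C.output k (c.input i w)) = w k
    · simp only [h, if_true]; positivity
    · rw [if_neg h, if_pos ⟨k, h⟩, Nat.cast_one]
  have hfano := condH_le_fano (msgLaw_nonneg (M := M)) sum_msgLaw (fun w => w k)
    (fun w i => C.output k (c.input i w)) (c.dec k) he
  rw [condH_eq_sub msgLaw_nonneg, Fintype.card_fin] at hfano
  have h1 : H (msgLaw M) (fun w => (w k, fun i => C.output k (c.input i w))) =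
      H (msgLaw M) (fun w => (w k, fun i => C.intf k (c.input i w))) := by
    refine H_congr fun w w' => ?_
    simp only [Prod.mk.injEq, funext_iff]
    refine and_congr_right fun hw => forall_congr' fun i => ?_
    have hl : C.link k k (c.input i w') = C.link k k (c.input i w) := by
      simp only [link, input, hw]
    simp only [output, hl]
    exact (C.f_inj_right k _).eq_iff
  have h2 := H_pair_msgLaw (M := M) {k} (A := fun w => w k)
    (B := fun w i => C.intf k (c.input i w)) (fun w w' => by simp [mixOn]) (fun w w' => by
      funext i
      simp only [intf, input_mixOn]
      rw [C.link_mixOn_of_notMem (by simpa using intfA_ne k),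
        C.link_mixOn_of_notMem (by simpa using intfB_ne k)])
  rw [h1, h2, H_msg] at hfano
  linarith

/-- Fano's inequality, with the interference removed by `H(Y_k) ≤ H(X_{kk}) + H(S_k)`. -/
theorem logb_le_H_direct (C : DIC3 X V S Y) (c : DIC3Code X Y n M) (k : Fin 3) :
    Real.logb 2 (M k) ≤ H (msgLaw M) (fun w i => C.link k k (c.input i w)) +
        (1 + C.errorProb c * Real.logb 2 (M k)) := by
  have h := C.fano_receiver c k
  have h1 : H (msgLaw M) (fun w i => C.output k (c.input i w)) ≤ H (msgLaw M)
      (fun w => (fun i => C.link k k (c.input i w), fun i => C.intf k (c.input i w))) := by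
    refine H_mono msgLaw_nonneg fun w w' hw => ?_
    simp only [Prod.mk.injEq, funext_iff] at hw ⊢
    intro i
    rw [output, output, hw.1, hw.2]
  have h2 := H_pair_le msgLaw_nonneg sum_msgLaw 
    (fun (w : ∀ k, Fin (M k)) i => C.link k k (c.input i w))
    (fun w i => C.intf k (c.input i w))
  linarith

variable [∀ k, Nonempty (X k)]

theorem H_intf_eq (C : DIC3 X V S Y) (hinv : C.InvertibleCombining) (c : DIC3Code X Y n M)
    (k : Fin 3) :
    H (msgLaw M) (fun w i => C.intf k (c.input i w)) =
      H (msgLaw M) (fun w i => C.link (intfA k) k (c.input i w)) +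
        H (msgLaw M) (fun w i => C.link (intfB k) k (c.input i w)) := by
  rw [← H_pair_msgLaw (M := M) {intfA k}]
  · refine H_congr fun w w' => ?_
    simp only [Prod.mk.injEq, funext_iff, ← forall_and]
    refine forall_congr' fun i => ⟨fun h => hinv.links_eq h, fun h => ?_⟩
    rw [intf, intf, h.1, h.2]
  · intro w w'
    funext i
    rw [input_mixOn, C.link_mixOn_of_mem (by simp)]
  · intro w w'
    funext i
    rw [input_mixOn, C.link_mixOn_of_notMem (by simpa using (intfA_ne_intfB k).symm)]

theorem H_direct_le_cross (C : DIC3 X V S Y) (hstrong : C.StrongInterference)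
    (c : DIC3Code X Y n M) {l k : Fin 3} (hkl : k ≠ l) :
    H (msgLaw M) (fun w i => C.link l l (c.input i w)) ≤
      H (msgLaw M) (fun w i => C.link l k (c.input i w)) := by
  refine H_mono msgLaw_nonneg fun w w' hw => ?_
  simp only [funext_iff] at hw ⊢
  exact fun i => hstrong.direct_eq hkl (hw i)

/-- The bound on the rates of `k` and of one interferer `b`, for the block signals of a code. The
other interferer `a` stays in the inequality as `H(X_{ak}^n)`, either to be subtracted from
`H(Y_k^n)` or to be replaced by the rate of `a`. -/
theorem block_bounds (C : DIC3 X V S Y) (hstrong : C.StrongInterference)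
    (hinv : C.InvertibleCombining) (c : DIC3Code X Y n M) {ε : ℝ}
    (hεM : ∀ k, 1 + C.errorProb c * Real.logb 2 (M k) ≤ ε) (k a b : Fin 3)
    (hab : (a = intfA k ∧ b = intfB k) ∨ (a = intfB k ∧ b = intfA k)) :
    Real.logb 2 (M k) + Real.logb 2 (M b) + H (msgLaw M) (fun w i => C.link a k (c.input i w)) ≤
      H (msgLaw M) (fun w i => C.output k (c.input i w)) + 2 * ε := by
  have h1 := C.fano_receiver c k
  rw [C.H_intf_eq hinv] at h1
  have h2 := C.logb_le_H_direct c b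
  have h3 := hεM k
  have h4 := hεM b
  rcases hab with ⟨rfl, rfl⟩ | ⟨rfl, rfl⟩
  · have h5 := C.H_direct_le_cross hstrong c (intfB_ne k).symm
    linarith
  · have h5 := C.H_direct_le_cross hstrong c (intfA_ne k).symm
    linarith

theorem sharedBound_empiricalInput [Nonempty (Fin n)] (C : DIC3 X V S Y) (c : DIC3Code X Y n M)
    (j : Fin 3 × Option (Fin 3)) :
    (n : ℝ) * C.sharedBound c.empiricalInput j =
      ∑ i, C.letterBound (prob (msgLaw M) (c.input i)) j := by
  have hn : (n : ℝ) ≠ 0 := by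
    have : 0 < n := Fin.pos (Classical.arbitrary (Fin n))
    exact_mod_cast this.ne'
  rw [sharedBound_eq_sum, Finset.sum_apply, Finset.mul_sum]
  refine Finset.sum_congr rfl fun (i : Fin n) _ => ?_
  have hq : c.empiricalInput.pQ i = (n : ℝ)⁻¹ := by simp [empiricalInput, uniformPMF]
  have hlaw := c.condLaw_empiricalInput i
  rw [← hlaw, Pi.smul_apply, smul_eq_mul, ← mul_assoc]
  erw [hq]
  rw [mul_inv_cancel₀ hn, one_mul]

/-- The bounds for a given code, in terms of the letter entropies of its empirical input. -/
theorem rateSum_logb_le (C : DIC3 X V S Y) (hstrong : C.StrongInterference)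
    (hinv : C.InvertibleCombining) [Nonempty (Fin n)] (c : DIC3Code X Y n M) {ε : ℝ} (hε : 0 ≤ ε)
    (hεM : ∀ k, 1 + C.errorProb c * Real.logb 2 (M k) ≤ ε) (j : Fin 3 × Option (Fin 3)) :
    rateSum (fun k => Real.logb 2 (M k)) j ≤ n * C.sharedBound c.empiricalInput j + 3 * ε := by
  rw [sharedBound_empiricalInput]
  have hsum : ∀ k, ∑ l, Real.logb 2 (M l) =
      Real.logb 2 (M k) + Real.logb 2 (M (intfA k)) + Real.logb 2 (M (intfB k)) := fun k => by
    fin_cases k <;> simp [Fin.sum_univ_three, intfA, intfB] <;> ring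
  obtain ⟨k, o⟩ := j
  have hdir : ∀ l, Real.logb 2 (M l) ≤ H (msgLaw M) (fun w i => C.link l l (c.input i w)) + ε :=
    fun l => (C.logb_le_H_direct c l).trans (by linarith [hεM l])
  have hout : H (msgLaw M) (fun w i => C.output k (c.input i w)) ≤
      ∑ i, H (msgLaw M) (fun w => C.output k (c.input i w)) :=
    H_pi_le msgLaw_nonneg sum_msgLaw fun i w => C.output k (c.input i w)
  rcases o with _ | l
  · simp only [rateSum, letterBound, H_prob, hsum k]
    have h1 := C.block_bounds hstrong hinv c hεM k _ _ (Or.inl ⟨rfl, rfl⟩)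
    have h2 := C.H_direct_le_cross hstrong c (intfA_ne k).symm
    have h3 := hdir (intfA k)
    linarith
  · simp only [rateSum, letterBound]
    split_ifs with hlk
    · have h1 : H (msgLaw M) (fun w i => C.link k k (c.input i w)) ≤
          ∑ i, H (msgLaw M) (fun w => C.link k k (c.input i w)) :=
        H_pi_le msgLaw_nonneg sum_msgLaw fun i w => C.link k k (c.input i w)
      simp only [H_prob]
      linarith [hdir k]
    · simp only [condH_prob]
      have h1 := condH_pi_le msgLaw_nonneg sum_msgLaw
        (fun i (w : ∀ k, Fin (M k)) => C.output k (c.input i w))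
        (fun i w => C.link l k (c.input i w))
      rw [condH_eq_sub msgLaw_nonneg] at h1
      have h2 : H (msgLaw M) (fun w i => C.output k (c.input i w)) ≤ H (msgLaw M)
          (fun w => (fun i => C.output k (c.input i w), fun i => C.link l k (c.input i w))) :=
        H_mono msgLaw_nonneg fun w w' hw => (Prod.mk.inj hw).1
      have hl : l = intfA k ∨ l = intfB k := by
        revert hlk; fin_cases k <;> fin_cases l <;> simp [intfA, intfB]
      rcases hl with rfl | rfl
      · have h3 := C.block_bounds hstrong hinv c hεM k _ _ (Or.inl ⟨rfl, rfl⟩)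
        linarith [hsum k]
      · have h3 := C.block_bounds hstrong hinv c hεM k _ _ (Or.inr ⟨rfl, rfl⟩)
        linarith [hsum k]

theorem achievable_subset_closedRegion (C : DIC3 X V S Y) (hstrong : C.StrongInterference)
    (hinv : C.InvertibleCombining) : C.achievable ⊆ C.closedRegion := by
  rintro R ⟨hR, c, hc⟩
  refine C.mem_closedRegion_of_slack hR fun δ hδ => ?_
  set B : ℝ := ∑ k, R k + 1 with hB
  have hB0 : 0 < B := by have := Finset.sum_nonneg fun k (_ : k ∈ Finset.univ) => hR k; linarith
  have hRB : ∀ k, R k + 1 ≤ B := fun k => by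
    have := Finset.single_le_sum (fun k _ => hR k) (Finset.mem_univ k); linarith
  have hlim : Filter.Tendsto (fun n : ℕ => 3 * (1 / (n : ℝ) + C.errorProb (c n) * B)) Filter.atTop
      (nhds (3 * (0 + 0 * B))) :=
    ((tendsto_one_div_atTop_nhds_zero_nat (𝕜 := ℝ)).add (hc.mul_const B)).const_mul 3
  obtain ⟨n, hn, hn1⟩ := ((hlim.eventually (gt_mem_nhds (show 3 * (0 + 0 * B) < δ by simpa))).and
    (Filter.eventually_ge_atTop 1)).exists
  have hn0 : (1 : ℝ) ≤ n := by exact_mod_cast hn1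
  have : Nonempty (Fin n) := ⟨⟨0, hn1⟩⟩
  have : ∀ k, Nonempty (Fin (numMessages n R k)) := fun k => ⟨⟨0, by simp [numMessages]⟩⟩
  have hlog : ∀ k, Real.logb 2 (numMessages n R k) = ⌈(n : ℝ) * R k⌉₊ := fun k => by
    simp [numMessages, Real.logb_pow]
  have herr : 0 ≤ C.errorProb (c n) := by unfold errorProb; positivity
  have hεM : ∀ k, 1 + C.errorProb (c n) * Real.logb 2 (numMessages n R k) ≤
      1 + C.errorProb (c n) * (n * B) := fun k => by
    rw [hlog]
    gcongr
    have h1 := (Nat.ceil_lt_add_one (mul_nonneg (by linarith) (hR k) : 0 ≤ (n : ℝ) * R k)).le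
    have h2 := mul_le_mul_of_nonneg_left (hRB k) (show (0 : ℝ) ≤ n by linarith)
    linarith
  refine ⟨(c n).empiricalInput, fun j => ?_⟩
  have h1 := C.rateSum_logb_le hstrong hinv (c n) (by positivity) hεM j
  have h2 : n * rateSum R j ≤ rateSum (fun k => Real.logb 2 (numMessages n R k)) j := by
    rw [← rateSum_mul]
    exact rateSum_mono (fun k => by rw [hlog]; exact Nat.le_ceil _) j
  have h3 : (n : ℝ) * (3 * (1 / (n : ℝ) + C.errorProb (c n) * B)) =
      3 * (1 + C.errorProb (c n) * (n * B)) := by field_simp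
  have h4 := mul_le_mul_of_nonneg_left hn.le (show (0 : ℝ) ≤ n by linarith)
  refine le_of_mul_le_mul_left ?_ (show (0 : ℝ) < n by linarith)
  linarith

end DIC3

/-! ### Error exponents -/

/-- If `ρ` is below the mean of `-log₂ W`, then a small power of `2 ^ ρ * W` has mean less than
`1`, because the derivative of `s ↦ E[(2 ^ ρ * W) ^ s]` at `0` is the mean of `log (2 ^ ρ * W)`,
which is negative. -/
theorem exists_rpow_mean_lt_one {Ω : Type*} [Fintype Ω] {P W : Ω → ℝ} (hP1 : ∑ ω, P ω = 1)
    (hW0 : ∀ ω, 0 ≤ W ω) (hW : ∀ ω, P ω ≠ 0 → 0 < W ω) {ρ : ℝ}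
    (hρ : ρ < -∑ ω, P ω * Real.logb 2 (W ω)) :
    ∃ s : ℝ, 0 < s ∧ s ≤ 1 ∧ ((2 : ℝ) ^ ρ) ^ s * ∑ ω, P ω * W ω ^ s < 1 := by
  have hlog2 : 0 < Real.log 2 := Real.log_pos one_lt_two
  let φ : ℝ → ℝ := fun s => ∑ ω, P ω * ((2 : ℝ) ^ ρ * W ω) ^ s
  have hφ : ∀ s, φ s = ((2 : ℝ) ^ ρ) ^ s * ∑ ω, P ω * W ω ^ s := fun s => by
    simp only [φ, Finset.mul_sum]
    refine Finset.sum_congr rfl fun ω _ => ?_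
    rw [Real.mul_rpow (by positivity) (hW0 ω)]
    ring
  have hφ0 : φ 0 = 1 := by simp [φ, hP1]
  have hder : HasDerivAt φ (∑ ω, P ω * Real.log ((2 : ℝ) ^ ρ * W ω)) 0 := by
    refine HasDerivAt.fun_sum fun ω _ => ?_
    by_cases h : P ω = 0
    · simpa [h] using hasDerivAt_const (0 : ℝ) (0 : ℝ)
    · have h1 : 0 < (2 : ℝ) ^ ρ * W ω := mul_pos (by positivity) (hW ω h)
      have h2 := (Real.hasStrictDerivAt_const_rpow h1 0).hasDerivAt
      rw [Real.rpow_zero, one_mul] at h2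
      exact h2.const_mul (P ω)
  have hneg : ∑ ω, P ω * Real.log ((2 : ℝ) ^ ρ * W ω) < 0 := by
    have h1 : ∀ ω, P ω * Real.log ((2 : ℝ) ^ ρ * W ω) =
        P ω * (ρ * Real.log 2) + P ω * Real.logb 2 (W ω) * Real.log 2 := fun ω => by
      by_cases h : P ω = 0
      · simp [h]
      · rw [Real.log_mul (by positivity) (hW ω h).ne', Real.log_rpow two_pos, Real.logb]
        field_simp
    simp only [h1]
    rw [Finset.sum_add_distrib, ← Finset.sum_mul, ← Finset.sum_mul, hP1, ← mul_assoc, ← add_mul]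
    exact mul_neg_of_neg_of_pos (by linarith) hlog2
  have hslope := (hasDerivAt_iff_tendsto_slope.1 hder).mono_left
    (nhdsWithin_mono 0 fun x (hx : x ∈ Set.Ioi 0) => (Set.mem_Ioi.1 hx).ne')
  obtain ⟨s, hs, hs0, hs1⟩ := ((hslope.eventually (gt_mem_nhds hneg)).and
    (Ioc_mem_nhdsGT (zero_lt_one' ℝ))).exists
  refine ⟨s, hs0, hs1, ?_⟩
  rw [← hφ, ← hφ0]
  rw [slope_def_field, sub_zero, div_neg_iff] at hs
  rcases hs with ⟨_, h⟩ | ⟨h, _⟩ <;> linarith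

theorem le_rpow_of_le_one_of_le {a b s : ℝ} (ha : a ≤ 1) (hab : a ≤ b) (hb : 0 ≤ b) (hs : 0 < s)
    (hs1 : s ≤ 1) : a ≤ b ^ s := by
  rcases le_total 1 b with h | h
  · exact ha.trans (Real.one_le_rpow h hs.le)
  · exact hab.trans (Real.self_le_rpow_of_le_one hb h hs1)

/-- The senders whose messages are wrong in the error event at receiver `k` that the bound with
index `(k, o)` controls. -/
def wrongSet (k : Fin 3) : Option (Fin 3) → Finset (Fin 3)
  | none => Finset.univ
  | some l => if l = k then {k} else Finset.univ.erase l

theorem exists_wrongSet_eq : ∀ (k : Fin 3) (T : Finset (Fin 3)), k ∈ T → ∃ o, wrongSet k o = T := by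
  decide

theorem rateSum_eq_sum_wrongSet (R : Fin 3 → ℝ) (k : Fin 3) (o : Option (Fin 3)) :
    rateSum R (k, o) = ∑ l ∈ wrongSet k o, R l := by
  rcases o with _ | l
  · rfl
  · simp only [rateSum, wrongSet]
    split_ifs
    · simp
    · rw [Finset.sum_erase_eq_sub (Finset.mem_univ l)]

namespace DIC3

open FiniteEntropy

variable {X : Fin 3 → Type*} {V : Fin 3 → Fin 3 → Type*} {S Y : Fin 3 → Type*}
  [∀ k, Fintype (X k)]

/-- The probability that the output at receiver `k` does not change when the inputs of the senders
in `T` are drawn anew. -/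
noncomputable def confusion (C : DIC3 X V S Y) (k : Fin 3) (T : Finset (Fin 3))
    (P : (∀ k, X k) → ℝ) (x : ∀ k, X k) : ℝ :=
  prob P (fun y => C.output k (mixOn T y x)) (C.output k x)

theorem confusion_pos (C : DIC3 X V S Y) (k : Fin 3) (T : Finset (Fin 3))
    {P : (∀ k, X k) → ℝ} (hP : ∀ x, 0 ≤ P x) {x : ∀ k, X k} (hx : P x ≠ 0) :
    0 < C.confusion k T P x := by
  have h := prob_pos hP (fun y => C.output k (mixOn T y x)) hx
  have hmix : mixOn T x x = x := by funext j; simp [mixOn]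
  rwa [hmix] at h

variable [∀ l k, Fintype (V l k)] [∀ k, Fintype (Y k)]

/-- Bayes' rule for the confusion probability: the input of `l` affects the output at `k` only
through the link signal, which is independent of the other inputs. -/
theorem confusion_erase_mul (C : DIC3 X V S Y) {p : ∀ k, X k → ℝ}
    (hp : ∑ x, productLaw p x = 1) (k l : Fin 3) (hl : l ≠ k) (x : ∀ k, X k) :
    C.confusion k (Finset.univ.erase l) (productLaw p) x *
      prob (productLaw p) (C.link l k) (C.link l k x) =
      prob (productLaw p) (fun x => (C.output k x, C.link l k x)) (C.output k x, C.link l k x) := by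
  have hout : ∀ y z : ∀ j, X j, C.link l k y = C.link l k z →
      C.output k (mixOn (Finset.univ.erase l) y z) = C.output k y := by
    intro y z hyz
    have h : ∀ j, C.link j k (mixOn (Finset.univ.erase l) y z) = C.link j k y := fun j => by
      by_cases hj : j = l
      · subst hj
        rw [C.link_mixOn_of_notMem (by simp), hyz]
      · exact C.link_mixOn_of_mem (by simp [hj]) k y z
    simp only [output, intf, h]
  rw [confusion, ← prob_pair_of_disjoint hp (Finset.univ.erase l)]
  · refine prob_congr fun y => ?_
    rw [Prod.mk.injEq, Prod.mk.injEq]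
    exact and_congr_left fun h => by rw [hout y x h]
  · intro y z
    congr 1
    funext j
    simp only [mixOn]; split_ifs <;> rfl
  · exact fun y z => C.link_mixOn_of_notMem (by simp) k y z

/-- The mean of `-log₂` of the confusion probability is the entropy in the corresponding bound. -/
theorem letterBound_eq_confusion (C : DIC3 X V S Y) {p : ∀ k, X k → ℝ}
    (hp0 : ∀ k x, 0 ≤ p k x) (hp : ∑ x, productLaw p x = 1) (k : Fin 3) (o : Option (Fin 3)) :
    C.letterBound (productLaw p) (k, o) =
      -∑ x, productLaw p x * Real.logb 2 (C.confusion k (wrongSet k o) (productLaw p) x) := by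
  rcases o with _ | l
  · have h : ∀ x y : ∀ j, X j, mixOn Finset.univ y x = y := fun x y => by funext j; simp [mixOn]
    simp only [letterBound, H_eq_sum, confusion, wrongSet, h]
  · simp only [letterBound, wrongSet]
    split_ifs with hl
    · have h : ∀ x, C.confusion k {k} (productLaw p) x =
          prob (productLaw p) (C.link k k) (C.link k k x) := fun x => by
        have hintf : ∀ y, C.intf k (mixOn {k} y x) = C.intf k x := fun y => by
          rw [intf, C.link_mixOn_of_notMem (by simpa using intfA_ne k),
            C.link_mixOn_of_notMem (by simpa using intfB_ne k), intf]
        have hiff : ∀ y, C.output k (mixOn {k} y x) = C.output k x ↔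
            C.link k k y = C.link k k x := fun y => by
          rw [output, output, hintf, C.link_mixOn_of_mem (by simp)]
          exact (C.f_inj_left k _).eq_iff
        exact prob_congr hiff
      simp only [H_eq_sum, h]
    · rw [condH_eq_sum]
      congr 1
      refine Finset.sum_congr rfl fun x _ => ?_
      by_cases hx : productLaw p x = 0
      · simp [hx]
      · rw [← C.confusion_erase_mul hp k l hl,
          mul_div_cancel_right₀ _ (prob_pos (productLaw_nonneg hp0) (C.link l k) hx).ne']

/-- The mean of the `s`-th power of the confusion probability. -/
noncomputable def confusionMoment (C : DIC3 X V S Y) (p : TimeSharedInput X) (k : Fin 3)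
    (T : Finset (Fin 3)) (s : ℝ) : ℝ :=
  ∑ q, p.pQ q * ∑ x, p.condLaw q x * C.confusion k T (p.condLaw q) x ^ s

theorem confusionMoment_nonneg (C : DIC3 X V S Y) (p : TimeSharedInput X) (k : Fin 3)
    (T : Finset (Fin 3)) (s : ℝ) : 0 ≤ C.confusionMoment p k T s :=
  Finset.sum_nonneg fun q _ => mul_nonneg (p.pQ_mem.1 q) <| Finset.sum_nonneg fun x _ =>
    mul_nonneg (p.condLaw_nonneg q x)
      (Real.rpow_nonneg (prob_nonneg (p.condLaw_nonneg q) _ _) s)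

theorem exists_confusionMoment_lt_one (C : DIC3 X V S Y) (p : TimeSharedInput X) (k : Fin 3)
    (o : Option (Fin 3)) {ρ : ℝ} (hρ : ρ < C.sharedBound p (k, o)) :
    ∃ s : ℝ, 0 < s ∧ s ≤ 1 ∧ ((2 : ℝ) ^ ρ) ^ s * C.confusionMoment p k (wrongSet k o) s < 1 := by
  obtain ⟨s, hs0, hs1, hs⟩ := exists_rpow_mean_lt_one (P := p.law)
    (W := fun ω => C.confusion k (wrongSet k o) (p.condLaw ω.1) ω.2) p.sum_law
    (fun ω => prob_nonneg (p.condLaw_nonneg _) _ _)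
    (fun ω hω => C.confusion_pos k _ (p.condLaw_nonneg _) (right_ne_zero_of_mul hω)) (ρ := ρ) (by
      rw [sharedBound_eq_sum, Finset.sum_apply] at hρ
      refine hρ.trans_eq ?_
      simp only [Fintype.sum_prod_type, TimeSharedInput.law_apply, mul_assoc, ← Finset.mul_sum]
      rw [← Finset.sum_neg_distrib]
      refine Finset.sum_congr rfl fun q _ => ?_
      have h := C.letterBound_eq_confusion (fun k => (p.pX_mem k q).1) (p.sum_condLaw q) k o
      rw [Pi.smul_apply, smul_eq_mul, ← mul_neg]
      exact congrArg (p.pQ q * ·) h)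
  refine ⟨s, hs0, hs1, ?_⟩
  simpa only [confusionMoment, Fintype.sum_prod_type, TimeSharedInput.law_apply, mul_assoc,
    ← Finset.mul_sum] using hs

end DIC3

/-! ### Random coding -/

/-- The letters of all codewords at one time: `b k v` is the input of sender `k` for message `v`. -/
abbrev CodeLetters (X : Fin 3 → Type*) (M : Fin 3 → ℕ) := ∀ k, Fin (M k) → X k

namespace CodeLetters

variable {X : Fin 3 → Type*} {M : Fin 3 → ℕ}

/-- The inputs for the message triple `w`. -/
def select (b : CodeLetters X M) (w : ∀ k, Fin (M k)) : ∀ k, X k := fun k => b k (w k)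

/-- The codebook letters that are taken from `b'` for the messages in `w`, and from `b` for all
other messages. -/
def replaceAt (w : ∀ k, Fin (M k)) (b b' : CodeLetters X M) : CodeLetters X M :=
  fun k v => if v = w k then b' k v else b k v

theorem select_replaceAt_self (w : ∀ k, Fin (M k)) (b b' : CodeLetters X M) :
    (replaceAt w b b').select w = b'.select w := by
  funext k; simp [select, replaceAt]

theorem select_replaceAt {T : Finset (Fin 3)} {w w' : ∀ k, Fin (M k)}
    (h : ∀ l, w' l ≠ w l ↔ l ∈ T) (b b' : CodeLetters X M) :
    (replaceAt w b b').select w' = mixOn T (b.select w') (b'.select w) := by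
  funext k
  simp only [select, replaceAt, mixOn, ← h]
  by_cases hk : w' k = w k
  · simp [hk]
  · simp [hk]

end CodeLetters

namespace TimeSharedInput

variable {X : Fin 3 → Type*} [∀ k, Fintype (X k)] (p : TimeSharedInput X) {M : Fin 3 → ℕ}

/-- The law of the codebook letters at a time with `Q = q`: all letters are independent. -/
noncomputable def letterLaw (q : Fin p.m) (b : CodeLetters X M) : ℝ := ∏ k, ∏ v, p.pX k q (b k v)

theorem letterLaw_nonneg (q : Fin p.m) (b : CodeLetters X M) : 0 ≤ p.letterLaw q b :=
  Finset.prod_nonneg fun k _ => Finset.prod_nonneg fun _ _ => (p.pX_mem k q).1 _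

theorem sum_letterLaw_mul (q : Fin p.m) (w : ∀ k, Fin (M k)) (h : (∀ k, X k) → ℝ) :
    ∑ b : CodeLetters X M, p.letterLaw q b * h (b.select w) = ∑ x, p.condLaw q x * h x := by
  classical
  have hx : ∀ x : ∀ k, X k, ∑ b : CodeLetters X M,
      p.letterLaw q b * (if b.select w = x then 1 else 0) = p.condLaw q x := fun x => by
    have h1 : ∀ b : CodeLetters X M, p.letterLaw q b * (if b.select w = x then 1 else 0) =
        ∏ k, (∏ v, p.pX k q (b k v)) * (if b k (w k) = x k then (1 : ℝ) else 0) := fun b => by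
      rw [Finset.prod_mul_distrib, Finset.prod_ite_zero, Finset.prod_const_one]
      simp [funext_iff, CodeLetters.select, letterLaw]
    simp only [h1, condLaw, productLaw]
    rw [← Fintype.prod_sum (fun k (c : Fin (M k) → X k) =>
      (∏ v, p.pX k q (c v)) * (if c (w k) = x k then (1 : ℝ) else 0))]
    refine Finset.prod_congr rfl fun k _ => ?_
    rw [sum_prod_mul_apply (p := fun _ : Fin (M k) => p.pX k q) (fun _ => (p.pX_mem k q).2) (w k)
      fun a => if a = x k then (1 : ℝ) else 0]
    simp
  simp only [← hx, Finset.sum_mul]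
  rw [Finset.sum_comm]
  refine Finset.sum_congr rfl fun b _ => ?_
  simp

theorem sum_letterLaw (q : Fin p.m) : ∑ b : CodeLetters X M, p.letterLaw q b = 1 := by
  classical
  simp only [letterLaw]
  rw [← Fintype.prod_sum (fun k (c : Fin (M k) → X k) => ∏ v, p.pX k q (c v))]
  refine Finset.prod_eq_one fun k _ => ?_
  rw [← Fintype.prod_sum (fun (_ : Fin (M k)) a => p.pX k q a)]
  exact Finset.prod_eq_one fun _ _ => (p.pX_mem k q).2

variable {n : ℕ}

/-- The law of the codebook for a given time-sharing sequence. -/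
noncomputable def bookLaw (q : Fin n → Fin p.m) (f : Fin n → CodeLetters X M) : ℝ :=
  ∏ i, p.letterLaw (q i) (f i)

theorem bookLaw_nonneg (q : Fin n → Fin p.m) (f : Fin n → CodeLetters X M) : 0 ≤ p.bookLaw q f :=
  Finset.prod_nonneg fun _ _ => p.letterLaw_nonneg _ _

theorem sum_bookLaw_mul_prod (q : Fin n → Fin p.m) (h : Fin n → CodeLetters X M → ℝ) :
    ∑ f, p.bookLaw q f * ∏ i, h i (f i) = ∏ i, ∑ b, p.letterLaw (q i) b * h i b := by
  classical
  simp only [bookLaw, ← Finset.prod_mul_distrib]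
  exact (Fintype.prod_sum fun i b => p.letterLaw (q i) b * h i b).symm

theorem sum_bookLaw (q : Fin n → Fin p.m) :
    ∑ f : Fin n → CodeLetters X M, p.bookLaw q f = 1 := by
  simpa [sum_letterLaw] using p.sum_bookLaw_mul_prod (M := M) q fun _ _ => 1

/-- Drawing the codewords of the triple `w` anew does not change the law of the codebook. -/
theorem bookLaw_exchange (q : Fin n → Fin p.m) (w : ∀ k, Fin (M k))
    (F : (Fin n → CodeLetters X M) → ℝ) :
    ∑ g, ∑ f, p.bookLaw q g * p.bookLaw q f * F (fun i => (f i).replaceAt w (g i)) =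
      ∑ f, p.bookLaw q f * F f := by
  have h := sum_sum_exchange (p.bookLaw q)
    (fun g f i => CodeLetters.replaceAt w (f i) (g i)) (fun g f => by
      funext i k v; simp only [CodeLetters.replaceAt]; split_ifs <;> rfl) (fun g f => by
      simp only [bookLaw, letterLaw, ← Finset.prod_mul_distrib]
      refine Finset.prod_congr rfl fun i _ => Finset.prod_congr rfl fun k _ =>
        Finset.prod_congr rfl fun v _ => ?_
      simp only [CodeLetters.replaceAt]
      split_ifs
      · rfl
      · exact mul_comm _ _) fun g _ => F g
  rw [h]
  refine Finset.sum_congr rfl fun g _ => ?_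
  rw [← Finset.sum_mul, ← Finset.mul_sum, sum_bookLaw, mul_one]

end TimeSharedInput

namespace DIC3

open FiniteEntropy CodeLetters

variable {X : Fin 3 → Type*} {V : Fin 3 → Fin 3 → Type*} {S Y : Fin 3 → Type*}
  {n : ℕ} {M : Fin 3 → ℕ}

/-- Some message triple that differs from `w` exactly for the senders in `T` gives the same output
sequence as `w` at receiver `k`. -/
def Confused (C : DIC3 X V S Y) (k : Fin 3) (T : Finset (Fin 3)) (w : ∀ l, Fin (M l))
    (f : Fin n → CodeLetters X M) : Prop :=
  ∃ w', (∀ l, w' l ≠ w l ↔ l ∈ T) ∧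
    ∀ i, C.output k ((f i).select w') = C.output k ((f i).select w)

theorem card_wrong_le (T : Finset (Fin 3)) (w : ∀ l, Fin (M l)) :
    Finset.card {w' : ∀ l, Fin (M l) | ∀ l, w' l ≠ w l ↔ l ∈ T} ≤ ∏ l ∈ T, M l := by
  classical
  refine (Finset.card_le_card (t := Fintype.piFinset fun l => if l ∈ T then Finset.univ else {w l})
    fun w' hw' => ?_).trans_eq ?_
  · rw [Finset.mem_filter_univ] at hw'
    rw [Fintype.mem_piFinset]
    intro l
    by_cases hl : l ∈ T
    · simp [hl]
    · simpa [hl] using not_imp_not.2 (hw' l).1 hl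
  · rw [Fintype.card_piFinset, ← Finset.prod_filter_mul_prod_filter_not Finset.univ (· ∈ T)]
    rw [Finset.prod_eq_one (s := Finset.univ.filter (· ∉ T)) fun l hl => by
      simp [(Finset.mem_filter.1 hl).2], mul_one, Finset.filter_mem_eq_inter, Finset.univ_inter]
    exact Finset.prod_congr rfl fun l hl => by simp [hl]

variable [∀ k, Fintype (X k)]

open Classical in
/-- The probability of a wrong but consistent message triple: given the correct codewords, the other
codewords are independent of them, and the union bound applies. -/
theorem sum_confused_le (C : DIC3 X V S Y) (p : TimeSharedInput X) (q : Fin n → Fin p.m) (k : Fin 3)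
    (T : Finset (Fin 3)) (w : ∀ l, Fin (M l)) {s : ℝ} (hs : 0 < s) (hs1 : s ≤ 1) :
    ∑ f : Fin n → CodeLetters X M, p.bookLaw q f * (if C.Confused k T w f then 1 else 0) ≤
      ∑ g : Fin n → CodeLetters X M, p.bookLaw q g * (((∏ l ∈ T, M l : ℕ) : ℝ) *
        ∏ i, C.confusion k T (p.condLaw (q i)) ((g i).select w)) ^ s := by
  rw [← p.bookLaw_exchange q w]
  refine Finset.sum_le_sum fun g _ => ?_
  simp only [mul_assoc, ← Finset.mul_sum]
  refine mul_le_mul_of_nonneg_left ?_ (p.bookLaw_nonneg q g)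
  have hprod : 0 ≤ ∏ i, C.confusion k T (p.condLaw (q i)) ((g i).select w) :=
    Finset.prod_nonneg fun i _ => prob_nonneg (p.condLaw_nonneg _) _ _
  refine le_rpow_of_le_one_of_le ?_ ?_ (by positivity) hs hs1
  · refine (Finset.sum_le_sum fun f _ => mul_le_of_le_one_right (p.bookLaw_nonneg q f) ?_).trans_eq
      (p.sum_bookLaw (M := M) q)
    split_ifs
    · exact le_rfl
    · exact zero_le_one
  -- the event for a fixed wrong triple `w'` splits into independent events at the times `i`
  have hunion : ∀ f : Fin n → CodeLetters X M,
      (if C.Confused k T w (fun i => (f i).replaceAt w (g i)) then (1 : ℝ) else 0) ≤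
        ∑ w' : ∀ l, Fin (M l) with ∀ l, w' l ≠ w l ↔ l ∈ T,
          ∏ i, if C.output k (mixOn T ((f i).select w') ((g i).select w)) =
            C.output k ((g i).select w) then (1 : ℝ) else 0 := fun f => by
    have hnn : ∀ w' ∈ Finset.univ.filter (fun w' : ∀ l, Fin (M l) => ∀ l, w' l ≠ w l ↔ l ∈ T),
        0 ≤ ∏ i, if C.output k (mixOn T ((f i).select w') ((g i).select w)) =
            C.output k ((g i).select w) then (1 : ℝ) else 0 :=
      fun w' _ => Finset.prod_nonneg fun i _ => by split_ifs <;> norm_num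
    split_ifs with h
    · obtain ⟨w', hw', hout⟩ := h
      refine le_trans (le_of_eq ?_) (Finset.single_le_sum hnn
        (Finset.mem_filter.2 ⟨Finset.mem_univ w', hw'⟩))
      refine (Finset.prod_eq_one fun i _ => if_pos ?_).symm
      rw [← select_replaceAt hw', hout i, select_replaceAt_self]
    · exact Finset.sum_nonneg hnn
  calc ∑ f, p.bookLaw q f *
        (if C.Confused k T w (fun i => (f i).replaceAt w (g i)) then (1 : ℝ) else 0)
      ≤ ∑ f, p.bookLaw q f * ∑ w' : ∀ l, Fin (M l) with ∀ l, w' l ≠ w l ↔ l ∈ T,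
          ∏ i, (if C.output k (mixOn T ((f i).select w') ((g i).select w)) =
            C.output k ((g i).select w) then (1 : ℝ) else 0) :=
        Finset.sum_le_sum fun f _ => mul_le_mul_of_nonneg_left (hunion f) (p.bookLaw_nonneg q f)
    _ = ∑ w' : ∀ l, Fin (M l) with ∀ l, w' l ≠ w l ↔ l ∈ T,
          ∏ i, C.confusion k T (p.condLaw (q i)) ((g i).select w) := by
        simp only [Finset.mul_sum]
        rw [Finset.sum_comm]
        refine Finset.sum_congr rfl fun w' _ => ?_
        rw [p.sum_bookLaw_mul_prod q fun i b =>
          if C.output k (mixOn T (b.select w') ((g i).select w)) =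
            C.output k ((g i).select w) then (1 : ℝ) else 0]
        refine Finset.prod_congr rfl fun i _ => ?_
        rw [p.sum_letterLaw_mul (q i) w' fun x =>
          if C.output k (mixOn T x ((g i).select w)) =
            C.output k ((g i).select w) then (1 : ℝ) else 0, confusion, prob_eq_sum_ite]
    _ ≤ ((∏ l ∈ T, M l : ℕ) : ℝ) * ∏ i, C.confusion k T (p.condLaw (q i)) ((g i).select w) := by
        rw [Finset.sum_const, nsmul_eq_mul]
        exact mul_le_mul_of_nonneg_right (by exact_mod_cast card_wrong_le T w) hprod

open Classical in
/-- The probability of a wrong but consistent message triple, averaged over the time-sharing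
sequence as well. -/
theorem sum_sum_confused_le (C : DIC3 X V S Y) (p : TimeSharedInput X) (k : Fin 3)
    (T : Finset (Fin 3)) (w : ∀ l, Fin (M l)) {s : ℝ} (hs : 0 < s) (hs1 : s ≤ 1) :
    ∑ q : Fin n → Fin p.m, (∏ i, p.pQ (q i)) *
      ∑ f : Fin n → CodeLetters X M, p.bookLaw q f * (if C.Confused k T w f then 1 else 0) ≤
      ((∏ l ∈ T, M l : ℕ) : ℝ) ^ s * C.confusionMoment p k T s ^ n := by
  have hconf : ∀ q x, 0 ≤ C.confusion k T (p.condLaw q) x :=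
    fun q x => prob_nonneg (p.condLaw_nonneg _) _ _
  calc _ ≤ ∑ q : Fin n → Fin p.m, (∏ i, p.pQ (q i)) * (((∏ l ∈ T, M l : ℕ) : ℝ) ^ s *
          ∏ i, ∑ x, p.condLaw (q i) x * C.confusion k T (p.condLaw (q i)) x ^ s) := by
        refine Finset.sum_le_sum fun q _ => mul_le_mul_of_nonneg_left
          ((C.sum_confused_le p q k T w hs hs1).trans_eq ?_)
          (Finset.prod_nonneg fun i _ => p.pQ_mem.1 _)
        have h1 : ∀ g : Fin n → CodeLetters X M, p.bookLaw q g * (((∏ l ∈ T, M l : ℕ) : ℝ) *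
            ∏ i, C.confusion k T (p.condLaw (q i)) ((g i).select w)) ^ s =
            ((∏ l ∈ T, M l : ℕ) : ℝ) ^ s * (p.bookLaw q g *
              ∏ i, C.confusion k T (p.condLaw (q i)) ((g i).select w) ^ s) := fun g => by
          rw [Real.mul_rpow (by positivity) (Finset.prod_nonneg fun i _ => hconf _ _),
            Real.finsetProd_rpow _ _ fun i _ => hconf _ _]
          ring
        simp only [h1, ← Finset.mul_sum]
        rw [p.sum_bookLaw_mul_prod q fun i b =>
          C.confusion k T (p.condLaw (q i)) (b.select w) ^ s]
        congr 1
        exact Finset.prod_congr rfl fun i _ => p.sum_letterLaw_mul (q i) w fun x =>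
          C.confusion k T (p.condLaw (q i)) x ^ s
    _ = ((∏ l ∈ T, M l : ℕ) : ℝ) ^ s * C.confusionMoment p k T s ^ n := by
        simp only [mul_left_comm _ (((∏ l ∈ T, M l : ℕ) : ℝ) ^ s), ← Finset.mul_sum,
          ← Finset.prod_mul_distrib]
        rw [← Fintype.prod_sum (fun (_ : Fin n) q =>
          p.pQ q * ∑ x, p.condLaw q x * C.confusion k T (p.condLaw q) x ^ s)]
        simp [confusionMoment]

variable [∀ k, Nonempty (Fin (M k))]

open Classical in
/-- The code with codebook `f` whose receivers choose any message triple that is consistent with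
the output. -/
noncomputable def codeOfBook (C : DIC3 X V S Y) (f : Fin n → CodeLetters X M) :
    DIC3Code X Y n M where
  enc k v i := f i k v
  dec k y := if h : ∃ w, (fun i => C.output k ((f i).select w)) = y then h.choose k
    else Classical.arbitrary _

/-- A decoding error at receiver `k` comes from a wrong consistent triple, whose set of wrong
entries contains `k`. -/
theorem exists_confused (C : DIC3 X V S Y) (f : Fin n → CodeLetters X M) (w : ∀ l, Fin (M l))
    (k : Fin 3)
    (h : (C.codeOfBook f).dec k (fun i => C.output k fun l => (C.codeOfBook f).enc l (w l) i) ≠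
      w k) :
    ∃ o, C.Confused k (wrongSet k o) w f := by
  classical
  have hex : ∃ w', (fun i => C.output k ((f i).select w')) =
      fun i => C.output k fun l => (C.codeOfBook f).enc l (w l) i := ⟨w, rfl⟩
  have hne : hex.choose k ≠ w k := by
    have hdec : (C.codeOfBook f).dec k
        (fun i => C.output k fun l => (C.codeOfBook f).enc l (w l) i) = hex.choose k := dif_pos hex
    rwa [hdec] at h
  obtain ⟨o, ho⟩ := exists_wrongSet_eq k (Finset.univ.filter fun l => hex.choose l ≠ w l)
    (by simpa using hne)
  exact ⟨o, hex.choose, fun l => by rw [ho]; simp, fun i => congrFun hex.choose_spec i⟩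

open Classical in
theorem errorProb_codeOfBook_le (C : DIC3 X V S Y) (f : Fin n → CodeLetters X M)
    (K : Finset (Fin 3)) (hK : ∀ k ∉ K, M k = 1) :
    C.errorProb (C.codeOfBook f) ≤ (Fintype.card (∀ k, Fin (M k)) : ℝ)⁻¹ * ∑ w : ∀ k, Fin (M k),
      ∑ k ∈ K, ∑ o, if C.Confused k (wrongSet k o) w f then 1 else 0 := by
  rw [errorProb, div_eq_inv_mul]
  refine mul_le_mul_of_nonneg_left ?_ (by positivity)
  rw [Finset.card_filter, Nat.cast_sum]
  refine Finset.sum_le_sum fun w _ => ?_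
  have hnn : ∀ k o, (0 : ℝ) ≤ if C.Confused k (wrongSet k o) w f then 1 else 0 :=
    fun k o => by split_ifs <;> norm_num
  split_ifs with h
  · obtain ⟨k, hk⟩ := h
    obtain ⟨o, ho⟩ := C.exists_confused f w k hk
    have hkK : k ∈ K := by
      by_contra hkK
      have : Subsingleton (Fin (M k)) := by rw [hK k hkK]; infer_instance
      exact hk (Subsingleton.elim _ _)
    refine le_trans ?_ (Finset.single_le_sum (f := fun k => ∑ o,
      if C.Confused k (wrongSet k o) w f then (1 : ℝ) else 0)
      (fun k _ => Finset.sum_nonneg fun o _ => hnn k o) hkK)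
    refine le_trans ?_ (Finset.single_le_sum (fun o _ => hnn k o) (Finset.mem_univ o))
    simp [ho]
  · simpa using Finset.sum_nonneg fun k _ => Finset.sum_nonneg fun o _ => hnn k o

/-- Some code is at least as good as the random code on average. -/
theorem exists_code (C : DIC3 X V S Y) (p : TimeSharedInput X) (K : Finset (Fin 3))
    (hK : ∀ k ∉ K, M k = 1) (s : Fin 3 → Option (Fin 3) → ℝ) (hs : ∀ k o, 0 < s k o)
    (hs1 : ∀ k o, s k o ≤ 1) :
    ∃ c : DIC3Code X Y n M, C.errorProb c ≤ ∑ k ∈ K, ∑ o,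
      ((∏ l ∈ wrongSet k o, M l : ℕ) : ℝ) ^ s k o *
        C.confusionMoment p k (wrongSet k o) (s k o) ^ n := by
  classical
  set B : ℝ := ∑ k ∈ K, ∑ o, ((∏ l ∈ wrongSet k o, M l : ℕ) : ℝ) ^ s k o *
        C.confusionMoment p k (wrongSet k o) (s k o) ^ n with hB
  by_contra! hlt
  have hQ : ∀ q : Fin n → Fin p.m, 0 ≤ ∏ i, p.pQ (q i) :=
    fun q => Finset.prod_nonneg fun i _ => p.pQ_mem.1 _
  have hQ1 : ∑ q : Fin n → Fin p.m, ∏ i, p.pQ (q i) = 1 := by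
    rw [← Fintype.prod_sum (fun (_ : Fin n) q => p.pQ q)]
    exact Finset.prod_eq_one fun _ _ => p.pQ_mem.2
  set E : (Fin n → CodeLetters X M) → ℝ := fun f => (Fintype.card (∀ k, Fin (M k)) : ℝ)⁻¹ *
    ∑ w : ∀ k, Fin (M k), ∑ k ∈ K, ∑ o, if C.Confused k (wrongSet k o) w f then 1 else 0 with hE
  have hEB : ∀ f, B < E f :=
    fun f => (hlt (C.codeOfBook f)).trans_le (C.errorProb_codeOfBook_le f K hK)
  set A : ℝ := ∑ q : Fin n → Fin p.m, (∏ i, p.pQ (q i)) *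
    ∑ f : Fin n → CodeLetters X M, p.bookLaw q f * E f with hA
  have hAle : A ≤ B := by
    have h1 : A = (Fintype.card (∀ k, Fin (M k)) : ℝ)⁻¹ * ∑ w : ∀ k, Fin (M k), ∑ k ∈ K, ∑ o,
        ∑ q : Fin n → Fin p.m, (∏ i, p.pQ (q i)) * ∑ f : Fin n → CodeLetters X M,
          p.bookLaw q f * (if C.Confused k (wrongSet k o) w f then 1 else 0) := by
      let L : ((Fin n → CodeLetters X M) → ℝ) → ℝ := fun G =>
        ∑ q : Fin n → Fin p.m, (∏ i, p.pQ (q i)) * ∑ f, p.bookLaw q f * G f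
      have hLsum : ∀ {ι : Type} (t : Finset ι) (F : ι → (Fin n → CodeLetters X M) → ℝ),
          L (fun f => ∑ i ∈ t, F i f) = ∑ i ∈ t, L (F i) := fun t F => by
        simp only [L, Finset.mul_sum]
        rw [Finset.sum_comm (s := t)]
        exact Finset.sum_congr rfl fun q _ => Finset.sum_comm
      have hLmul : ∀ (a : ℝ) (F : (Fin n → CodeLetters X M) → ℝ),
          L (fun f => a * F f) = a * L F := fun a F => by
        simp only [L, Finset.mul_sum]
        exact Finset.sum_congr rfl fun q _ => Finset.sum_congr rfl fun f _ => by ring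
      change L E = _
      simp only [hE, hLmul, hLsum]
      rfl
    have h2 : ∀ w : ∀ k, Fin (M k), ∑ k ∈ K, ∑ o,
        ∑ q : Fin n → Fin p.m, (∏ i, p.pQ (q i)) * ∑ f : Fin n → CodeLetters X M,
          p.bookLaw q f * (if C.Confused k (wrongSet k o) w f then 1 else 0) ≤ B := fun w =>
      Finset.sum_le_sum fun k _ => Finset.sum_le_sum fun o _ =>
        C.sum_sum_confused_le p k _ w (hs k o) (hs1 k o)
    have hcard : (Fintype.card (∀ k, Fin (M k)) : ℝ) ≠ 0 := by exact_mod_cast Fintype.card_ne_zero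
    rw [h1]
    refine (mul_le_mul_of_nonneg_left (Finset.sum_le_sum fun w _ => h2 w)
      (by positivity)).trans_eq ?_
    rw [Finset.sum_const, nsmul_eq_mul, Finset.card_univ, inv_mul_cancel_left₀ hcard]
  have hlow : B < A := by
    have hin : ∀ q : Fin n → Fin p.m,
        B < ∑ f : Fin n → CodeLetters X M, p.bookLaw q f * E f := fun q => by
      obtain ⟨f, -, hf⟩ := Finset.exists_ne_zero_of_sum_ne_zero
        (show ∑ f : Fin n → CodeLetters X M, p.bookLaw q f ≠ 0 by simp [p.sum_bookLaw q])
      calc B = ∑ f : Fin n → CodeLetters X M, p.bookLaw q f * B := by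
            rw [← Finset.sum_mul, p.sum_bookLaw, one_mul]
        _ < _ := Finset.sum_lt_sum
            (fun f _ => mul_le_mul_of_nonneg_left (hEB f).le (p.bookLaw_nonneg q f))
            ⟨f, Finset.mem_univ f, mul_lt_mul_of_pos_left (hEB f)
              (lt_of_le_of_ne (p.bookLaw_nonneg q f) hf.symm)⟩
    obtain ⟨q, -, hq⟩ := Finset.exists_ne_zero_of_sum_ne_zero
      (show ∑ q : Fin n → Fin p.m, ∏ i, p.pQ (q i) ≠ 0 by simp [hQ1])
    calc B = ∑ q : Fin n → Fin p.m, (∏ i, p.pQ (q i)) * B := by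
          rw [← Finset.sum_mul, hQ1, one_mul]
      _ < _ := Finset.sum_lt_sum (fun q _ => mul_le_mul_of_nonneg_left (hin q).le (hQ q))
          ⟨q, Finset.mem_univ q, mul_lt_mul_of_pos_left (hin q) (lt_of_le_of_ne (hQ q) hq.symm)⟩
  exact absurd hAle hlow.not_ge

end DIC3

/-! ### Achievability and the capacity region -/

theorem self_mem_wrongSet : ∀ (k : Fin 3) (o : Option (Fin 3)), k ∈ wrongSet k o := by decide

theorem prod_numMessages_le (n : ℕ) {R : Fin 3 → ℝ} (hR : ∀ k, 0 ≤ R k) (T : Finset (Fin 3)) :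
    ((∏ l ∈ T, numMessages n R l : ℕ) : ℝ) ≤ 2 ^ T.card * ((2 : ℝ) ^ ∑ l ∈ T, R l) ^ n := by
  have h : ∀ l, ((numMessages n R l : ℕ) : ℝ) ≤ 2 * (2 : ℝ) ^ (n * R l) := fun l => by
    have h1 := (Nat.ceil_lt_add_one (mul_nonneg n.cast_nonneg (hR l) : 0 ≤ (n : ℝ) * R l)).le
    rw [numMessages, Nat.cast_pow, Nat.cast_ofNat, ← Real.rpow_natCast]
    refine (Real.rpow_le_rpow_of_exponent_le one_le_two h1).trans_eq ?_
    rw [Real.rpow_add two_pos, Real.rpow_one, mul_comm]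
  rw [Nat.cast_prod]
  refine (Finset.prod_le_prod (fun l _ => Nat.cast_nonneg _) fun l _ => h l).trans_eq ?_
  rw [Finset.prod_mul_distrib, Finset.prod_const, ← Real.rpow_natCast (_ ^ _) n,
    ← Real.rpow_mul two_pos.le, Finset.sum_mul, Real.rpow_sum_of_pos two_pos]
  simp only [mul_comm]

theorem mem_closure_of_scaling {A : Set (Fin 3 → ℝ)} {R : Fin 3 → ℝ}
    (h : ∀ t : ℝ, 0 ≤ t → t < 1 → (fun k => t * R k) ∈ A) : R ∈ closure A := by
  have hcont : Continuous fun (t : ℝ) (k : Fin 3) => t * R k := by fun_prop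
  have hlim := (hcont.tendsto 1).mono_left (nhdsWithin_le_nhds (s := Set.Iio 1))
  simp only [one_mul] at hlim
  refine mem_closure_of_tendsto hlim ?_
  filter_upwards [Ico_mem_nhdsLT (zero_lt_one' ℝ)] with t ht
  exact h t ht.1 ht.2

namespace DIC3

open FiniteEntropy

variable {X : Fin 3 → Type*} {V : Fin 3 → Fin 3 → Type*} {S Y : Fin 3 → Type*}
  [∀ k, Fintype (X k)] [∀ l k, Fintype (V l k)] [∀ k, Fintype (Y k)]

/-- Rates are achievable if they satisfy strictly the bounds of all receivers with a positive
rate; the other receivers have nothing to decode. -/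
theorem mem_achievable_of_lt (C : DIC3 X V S Y) (p : TimeSharedInput X) {R : Fin 3 → ℝ}
    (hR : ∀ k, 0 ≤ R k)
    (h : ∀ k, R k ≠ 0 → ∀ o, rateSum R (k, o) < C.sharedBound p (k, o)) : R ∈ C.achievable := by
  classical
  -- receivers with rate `0` get the arbitrary exponent `1`, which the error bound never uses
  have hs : ∀ k o, ∃ s : ℝ, 0 < s ∧ s ≤ 1 ∧ (R k ≠ 0 →
      ((2 : ℝ) ^ rateSum R (k, o)) ^ s * C.confusionMoment p k (wrongSet k o) s < 1) := by
    intro k o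
    by_cases hk : R k = 0
    · exact ⟨1, one_pos, le_rfl, fun h0 => absurd hk h0⟩
    · obtain ⟨s, h0, h1, h2⟩ := C.exists_confusionMoment_lt_one p k o (h k hk o)
      exact ⟨s, h0, h1, fun _ => h2⟩
  choose s hs0 hs1 hs using hs
  have : ∀ n k, Nonempty (Fin (numMessages n R k)) := fun n k => ⟨⟨0, by simp [numMessages]⟩⟩
  have hK : ∀ n, ∀ k ∉ Finset.univ.filter (fun k => R k ≠ 0), numMessages n R k = 1 :=
    fun n k hk => by
      have : R k = 0 := by simpa using hk
      simp [numMessages, this]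
  choose c hc using fun n => C.exists_code (n := n) p _ (hK n) s hs0 hs1
  refine ⟨hR, c, ?_⟩
  refine squeeze_zero (fun n => by unfold errorProb; positivity) hc ?_
  suffices hterm : ∀ k, R k ≠ 0 → ∀ o, Filter.Tendsto (fun n : ℕ =>
      ((∏ l ∈ wrongSet k o, numMessages n R l : ℕ) : ℝ) ^ s k o *
        C.confusionMoment p k (wrongSet k o) (s k o) ^ n) Filter.atTop (nhds 0) by
    have hsum := tendsto_finsetSum (Finset.univ.filter fun k => R k ≠ 0) fun k hk =>
      tendsto_finsetSum Finset.univ fun o _ => hterm k (by simpa using hk) o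
    simpa only [Finset.sum_const_zero] using hsum
  intro k hk0 o
  set T := wrongSet k o with hT
  set Λ := C.confusionMoment p k T (s k o) with hΛ
  have hΛ0 : 0 ≤ Λ := C.confusionMoment_nonneg p k T _
  have hlt : ((2 : ℝ) ^ ∑ l ∈ T, R l) ^ s k o * Λ < 1 := by
    rw [hT, ← rateSum_eq_sum_wrongSet]; exact hs k o hk0
  have hlim := (tendsto_pow_atTop_nhds_zero_of_lt_one
    (mul_nonneg (by positivity) hΛ0) hlt).const_mul (((2 : ℝ) ^ T.card) ^ s k o)
  rw [mul_zero] at hlim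
  refine squeeze_zero (fun n => by positivity) (fun n => ?_) hlim
  rw [mul_pow, ← mul_assoc]
  refine mul_le_mul_of_nonneg_right ?_ (pow_nonneg hΛ0 n)
  refine (Real.rpow_le_rpow (by positivity) (prod_numMessages_le n hR T) (hs0 k o).le).trans_eq ?_
  rw [Real.mul_rpow (by positivity) (by positivity), ← Real.rpow_pow_comm (by positivity) (s k o) n]

theorem strictRegion_subset_achievable (C : DIC3 X V S Y) : C.strictRegion ⊆ C.achievable := by
  intro R hR
  obtain ⟨hR0, p, hp⟩ := (C.mem_strictRegion_iff R).1 hR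
  exact C.mem_achievable_of_lt p hR0 fun k _ o => hp (k, o)

variable [∀ k, Nonempty (X k)]

/-- For uniform inputs, all bounds of a receiver whose direct link is not constant are positive. -/
theorem letterBound_uniform_pos (C : DIC3 X V S Y) {k : Fin 3}
    (hk : ∃ x x', C.g k k x ≠ C.g k k x') (o : Option (Fin 3)) :
    0 < C.letterBound (productLaw fun j => uniformPMF (X j)) (k, o) := by
  classical
  set P : (∀ j, X j) → ℝ := productLaw fun j => uniformPMF (X j) with hP
  have hpos : ∀ x, 0 < P x := fun x => Finset.prod_pos fun j _ => uniformPMF_pos _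
  have hP1 : ∑ x, P x = 1 := sum_productLaw_eq_one fun _ => uniformPMF_mem
  have hconf0 : ∀ x, 0 < C.confusion k (wrongSet k o) P x :=
    fun x => C.confusion_pos k _ (fun y => (hpos y).le) (hpos x).ne'
  have hconf1 : ∀ x, C.confusion k (wrongSet k o) P x ≤ 1 := fun x => by
    rw [confusion, prob_eq_sum_ite]
    exact (Finset.sum_le_sum fun y _ => mul_le_of_le_one_right (hpos y).le
      (by split_ifs <;> norm_num)).trans_eq hP1
  obtain ⟨a, a', ha⟩ := hk
  let x : ∀ j, X j := Function.update (fun j => Classical.arbitrary (X j)) k a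
  let y : ∀ j, X j := Function.update x k a'
  have hmix : mixOn (wrongSet k o) y x = y := by
    funext j
    simp only [mixOn]
    split_ifs with hj
    · rfl
    · have : j ≠ k := fun h => hj (h ▸ self_mem_wrongSet k o)
      simp [y, this]
  have hout : C.output k y ≠ C.output k x := by
    have hintf : C.intf k y = C.intf k x := by
      simp [intf, link, y, intfA_ne, intfB_ne]
    rw [output, output, hintf]
    refine fun h => ha ?_
    simpa [link, x, y] using (C.f_inj_left k _ h).symm
  have hx : C.confusion k (wrongSet k o) P x < 1 := by
    rw [confusion, prob_eq_sum_ite]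
    refine (Finset.sum_lt_sum (fun y _ => mul_le_of_le_one_right (hpos y).le
      (by split_ifs <;> norm_num)) ⟨y, Finset.mem_univ y, ?_⟩).trans_eq hP1
    rw [hmix, if_neg hout, mul_zero]
    exact hpos y
  rw [C.letterBound_eq_confusion (fun j => uniformPMF_mem.1) hP1, neg_pos]
  refine Finset.sum_neg' (fun z _ => mul_nonpos_of_nonneg_of_nonpos (hpos z).le
    (Real.logb_nonpos one_lt_two (hconf0 z).le (hconf1 z))) ⟨x, Finset.mem_univ x, ?_⟩
  exact mul_neg_of_pos_of_neg (hpos x) (Real.logb_neg one_lt_two (hconf0 x) hx)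

/-- The bound `H(X_{kk} | Q)` vanishes if the direct link of `k` is constant. -/
theorem sharedBound_self_nonpos (C : DIC3 X V S Y) (p : TimeSharedInput X) {k : Fin 3}
    (hk : ¬∃ x x', C.g k k x ≠ C.g k k x') : C.sharedBound p (k, some k) ≤ 0 := by
  push Not at hk
  rw [sharedBound_eq_sum, Finset.sum_apply]
  refine Finset.sum_nonpos fun q _ => mul_nonpos_of_nonneg_of_nonpos (p.pQ_mem.1 q) ?_
  have h1 : H (p.condLaw q) (fun _ => ()) = 0 := by simp [H, prob, p.sum_condLaw q]
  simp only [letterBound, if_true]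
  rw [← h1]
  exact H_mono (p.condLaw_nonneg q) fun x x' _ => hk _ _

/-- Mixing in a little of the uniform inputs makes the bounds strict after scaling the rates. -/
theorem exists_lt_sharedBound (C : DIC3 X V S Y) (p : TimeSharedInput X) {R : Fin 3 → ℝ}
    (hp : rateSum R ≤ C.sharedBound p) {t : ℝ} (ht : 0 ≤ t) (ht1 : t < 1) :
    ∃ p' : TimeSharedInput X, ∀ k, (∃ x x', C.g k k x ≠ C.g k k x') → ∀ o,
      rateSum (fun k => t * R k) (k, o) < C.sharedBound p' (k, o) := by
  have h1 := (C.mem_convexHull_letterSet_iff _).2 ⟨p, rfl⟩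
  have h2 : C.letterBound (productLaw fun j => uniformPMF (X j)) ∈ convexHull ℝ C.letterSet :=
    subset_convexHull ℝ _ ⟨fun j => uniformPMF (X j), fun j _ => uniformPMF_mem, rfl⟩
  obtain ⟨p', hp'⟩ := (C.mem_convexHull_letterSet_iff _).1
    (convex_convexHull ℝ C.letterSet h1 h2 ht (sub_nonneg.2 ht1.le) (add_sub_cancel t 1))
  refine ⟨p', fun k hk o => ?_⟩
  rw [hp', rateSum_mul, Pi.add_apply, Pi.smul_apply, Pi.smul_apply, smul_eq_mul, smul_eq_mul]
  have h3 := mul_pos (sub_pos.2 ht1) (C.letterBound_uniform_pos hk o)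
  have h4 := mul_le_mul_of_nonneg_left (hp (k, o)) ht
  linarith

theorem closedRegion_subset_closure_achievable (C : DIC3 X V S Y) :
    C.closedRegion ⊆ closure C.achievable := by
  intro R hR
  obtain ⟨hR0, p, hp⟩ := (C.mem_closedRegion_iff R).1 hR
  refine mem_closure_of_scaling fun t ht ht1 => ?_
  obtain ⟨p', hp'⟩ := C.exists_lt_sharedBound p hp ht ht1
  refine C.mem_achievable_of_lt p' (fun k => mul_nonneg ht (hR0 k)) fun k hk => hp' k ?_
  by_contra hconst
  have h1 := (hp (k, some k)).trans (C.sharedBound_self_nonpos p hconst)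
  have h2 : R k ≤ 0 := by simpa [rateSum] using h1
  exact hk (by rw [le_antisymm h2 (hR0 k), mul_zero])

theorem closedRegion_subset_closure_strictRegion (C : DIC3 X V S Y)
    (hg : ∀ k, ∃ x x', C.g k k x ≠ C.g k k x') : C.closedRegion ⊆ closure C.strictRegion := by
  intro R hR
  obtain ⟨hR0, p, hp⟩ := (C.mem_closedRegion_iff R).1 hR
  refine mem_closure_of_scaling fun t ht ht1 => ?_
  obtain ⟨p', hp'⟩ := C.exists_lt_sharedBound p hp ht ht1
  exact (C.mem_strictRegion_iff _).2
    ⟨fun k => mul_nonneg ht (hR0 k), p', fun j => hp' j.1 (hg j.1) j.2⟩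

end DIC3

theorem theorem2
    {X : Fin 3 → Type*} {V : Fin 3 → Fin 3 → Type*} {S Y : Fin 3 → Type*}
    [∀ k, Fintype (X k)] [∀ k, Nonempty (X k)] [∀ l k, Fintype (V l k)]
    [∀ k, Fintype (S k)] [∀ k, Fintype (Y k)]
    (C : DIC3 X V S Y) (hstrong : C.StrongInterference) (hinv : C.InvertibleCombining) :
    C.strictRegion ⊆ C.achievable ∧
    C.capacityRegion = C.closedRegion ∧
    ((∀ k, ∃ x x', C.g k k x ≠ C.g k k x') → C.capacityRegion = closure C.strictRegion) := by
  have hcap : C.capacityRegion = C.closedRegion :=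
    (closure_minimal (C.achievable_subset_closedRegion hstrong hinv)
      C.isClosed_closedRegion).antisymm C.closedRegion_subset_closure_achievable
  refine ⟨C.strictRegion_subset_achievable, hcap, fun hg => ?_⟩
  refine Set.Subset.antisymm ?_ (closure_mono C.strictRegion_subset_achievable)
  rw [hcap]
  exact C.closedRegion_subset_closure_strictRegion hg
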